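/- Let $n\ge 3$ be an odd integer, $k=\frac{n-3}{2}$, $\mathbb B$ the open unit ball of $\mathbb R^n$, and $\omega_d$ the surface area of the unit sphere $\mathbb S^d\subset\mathbb R^{d+1}$. Let $f\in C_c^\infty(\mathbb B)$ be complex-valued, and for $p\in\mathbb S^{n-1}$, $t>0$ put $$\mathcal Rf(p,t)=\frac1{\omega_{n-1}}\int_{\mathbb S^{n-1}}f(p+t\theta)\,dS(\theta).$$ For each $q\ge 0$ let $\{Y_{q,s}\}_{1\le s\le d_q}$ be an orthonormal basis in $L^2(\mathbb S^{n-1},dS)$ of the space of spherical harmonics of degree $q$ (restrictions to $\mathbb S^{n-1}$ of harmonic homogeneous polynomials of degree $q$), where $d_q=\frac{(2q+n-2)(n+q-3)!}{q!\,(n-2)!}$. Put $$f_{q,s}(r)=\int_{\mathbb S^{n-1}}f(r\theta)\overline{Y_{q,s}(\theta)}\,dS(\theta),\qquad g_{q,s}(t)=\int_{\mathbb S^{n-1}}\mathcal Rf(\theta,t)\overline{Y_{q,s}(\theta)}\,dS(\theta),$$ $$\widetilde f_{q,s}(t)=\frac{f_{q,s}(t)}{t^q},\qquad h_{q,s}(t)=\frac{\omega_{2k+2}\,t^{2k+1}}{\omega_{2k+1}}\,g_{q,s}(t),\qquad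 D=\frac1t\frac{d}{dt}.$$ Then for all $q\ge0$ and $1\le s\le d_q$: 1. $h_{q,s}$ and $\widetilde f_{q,s}$ are smooth on $(0,1)$, and for every $t\in(0,1)$ the function $y=\widetilde f_{q,s}$ satisfies $$\Big[\frac{d}{dt}D^{q+2k}h_{q,s}\Big](t)=\frac{(-1)^{q+k}k!}{2^q}\sum_{m=0}^{q+k}\sum_{\nu=m}^{q+k}\sum_{l=\nu}^{q+k}2^{l+m-\nu}\frac{(2q+2k-l)!}{(q+k-l)!\,m!}\binom{l+1}{\nu+1}\binom{l+\nu-m}{\nu-m}\frac1{t^l}\frac{(1-t)^{\nu+1}}{t^{\nu-m}}\,y^{(m)}(1-t).\qquad(*)$$ 2. Let $\epsilon>0$, and let $\epsilon'>0$ be such that $\epsilon<1-\epsilon'$ and the sphere $\{|x|=1-\epsilon'\}$ does not meet the support of $f$ (every sufficiently small $\epsilon'>0$ has the latter property). Then $\widetilde f_{q,s}$ is recovered on $(\epsilon,1)$ as the unique solution of the initial value problem: a function $y$ is of class $C^{q+k}$ on $(\epsilon,1)$, satisfies $(*)$ for all $t\in(0,1-\epsilon)$, and satisfies $y^{(i)}(1-\epsilon')=0$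 for $0\le i\le q+k-1$, if and only if $y=\widetilde f_{q,s}$ on $(\epsilon,1)$. -/

import Mathlib

open MeasureTheory Set Metric
open scoped ContDiff

noncomputable section

namespace SphericalMean

/-- Euclidean space `ℝⁿ`. -/
abbrev Eucl (n : ℕ) : Type := EuclideanSpace ℝ (Fin n)

/-- The unit sphere `S^{n-1}` of `ℝⁿ`. -/
abbrev USphere (n : ℕ) : Type := sphere (0 : Eucl n) 1

/-- The surface measure `dS` on the unit sphere of `ℝⁿ`. -/
def surf (n : ℕ) : Measure (USphere n) := (volume : Measure (Eucl n)).toSphere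

/-- `ω_d`, the surface area of the `d`-dimensional unit sphere `S^d ⊆ ℝ^{d+1}`. -/
def omega (d : ℕ) : ℝ := (surf (d + 1)).real univ

/-- The spherical mean transform
`𝓡f(p,t) = (1/ω_{n-1}) ∫_{S^{n-1}} f(p + tθ) dS(θ)`. -/
def sphericalMean (n : ℕ) (f : Eucl n → ℂ) (p : Eucl n) (t : ℝ) : ℂ :=
  ((1 / omega (n - 1) : ℝ) : ℂ) * ∫ θ : USphere n, f (p + t • (θ : Eucl n)) ∂(surf n)

/-- `Y` is a spherical harmonic of degree `q` on `S^{n-1}`: the restriction to the sphere of a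
homogeneous polynomial of degree `q` with complex coefficients that is annihilated by the
Laplacian. -/
def IsSphericalHarmonic (n q : ℕ) (Y : USphere n → ℂ) : Prop :=
  ∃ P : MvPolynomial (Fin n) ℂ,
    P.IsHomogeneous q ∧
    (∑ i, MvPolynomial.pderiv i (MvPolynomial.pderiv i P)) = 0 ∧
    ∀ θ : USphere n, Y θ = MvPolynomial.eval (fun i => (((θ : Eucl n) i : ℝ) : ℂ)) P

/-- The dimension `d_q` of the space of spherical harmonics of degree `q` on `S^{n-1}`
(`n ≥ 3`); the division is exact. -/
def harmonicDim (n q : ℕ) : ℕ :=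
  (2 * q + n - 2) * (n + q - 3).factorial / (q.factorial * (n - 2).factorial)

/-- For every degree `q`, the functions `Y q s` form an orthonormal basis (with respect to the
surface measure) of the space of spherical harmonics of degree `q`. -/
structure IsHarmonicBasis (n : ℕ) (Y : (q : ℕ) → Fin (harmonicDim n q) → USphere n → ℂ) :
    Prop where
  harmonic : ∀ q s, IsSphericalHarmonic n q (Y q s)
  orthonormal : ∀ q s s',
    ∫ θ, Y q s θ * starRingEnd ℂ (Y q s' θ) ∂(surf n) = if s = s' then 1 else 0
  span : ∀ q Z, IsSphericalHarmonic n q Z → Z ∈ Submodule.span ℂ (range (Y q))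

/-- The coefficient `f_Y(r) = ∫_{S^{n-1}} f(rθ) conj(Y(θ)) dS(θ)` of a function on `ℝⁿ`. -/
def coeffF (n : ℕ) (f : Eucl n → ℂ) (Y : USphere n → ℂ) (r : ℝ) : ℂ :=
  ∫ θ : USphere n, f (r • (θ : Eucl n)) * starRingEnd ℂ (Y θ) ∂(surf n)

/-- The coefficient `g_Y(t) = ∫_{S^{n-1}} g(θ,t) conj(Y(θ)) dS(θ)` of `g = 𝓡f`. -/
def coeffG (n : ℕ) (f : Eucl n → ℂ) (Y : USphere n → ℂ) (t : ℝ) : ℂ :=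
  ∫ θ : USphere n, sphericalMean n f (θ : Eucl n) t * starRingEnd ℂ (Y θ) ∂(surf n)

/-- `f̃_Y(t) = f_Y(t) / t^q`. -/
def coeffFTilde (n q : ℕ) (f : Eucl n → ℂ) (Y : USphere n → ℂ) (t : ℝ) : ℂ :=
  coeffF n f Y t / (t : ℂ) ^ q

/-- `h_Y(t) = ω_{2k+2} t^{2k+1} / ω_{2k+1} · g_Y(t)`. -/
def dataH (n k : ℕ) (f : Eucl n → ℂ) (Y : USphere n → ℂ) (t : ℝ) : ℂ :=
  ((omega (2 * k + 2) * t ^ (2 * k + 1) / omega (2 * k + 1) : ℝ) : ℂ) * coeffG n f Y t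

/-- The operator `D = (1/t) d/dt`. -/
def opD (φ : ℝ → ℂ) (t : ℝ) : ℂ := ((1 / t : ℝ) : ℂ) * deriv φ t

/-- The left-hand side `[(d/dt) D^{q+2k} h](t)`. -/
def odeLHS (q k : ℕ) (h : ℝ → ℂ) (t : ℝ) : ℂ := deriv (opD^[q + 2 * k] h) t

/-- The coefficient of `y^{(m)}(1-t)` in the right-hand side of the differential equation,
without the common factor `(-1)^{q+k} k! / 2^q`. All natural-number subtractions below are
exact, since `m ≤ ν ≤ l ≤ q + k`. -/
def odeCoeff (q k m : ℕ) (t : ℝ) : ℝ :=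
  ∑ ν ∈ Finset.Icc m (q + k), ∑ l ∈ Finset.Icc ν (q + k),
    (2 : ℝ) ^ (l + m - ν)
      * (((2 * q + 2 * k - l).factorial : ℝ) / ((q + k - l).factorial * m.factorial))
      * ((l + 1).choose (ν + 1) : ℝ) * ((l + ν - m).choose (ν - m) : ℝ)
      * (1 / t ^ l) * ((1 - t) ^ (ν + 1) / t ^ (ν - m))

/-- The right-hand side of the differential equation, applied to `y`. -/
def odeRHS (q k : ℕ) (y : ℝ → ℂ) (t : ℝ) : ℂ :=
  (((-1) ^ (q + k) * (k.factorial : ℝ) / 2 ^ q : ℝ) : ℂ)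
    * ∑ m ∈ Finset.range (q + k + 1),
        ((odeCoeff q k m t : ℝ) : ℂ) * iteratedDeriv m y (1 - t)

/-- `y` is a classical solution, on the interval `(ε, 1)` of the radial variable `r = 1 - t`,
of the differential equation with data `h`, with vanishing initial conditions at `1 - ε'`. -/
structure SolvesIVP (q k : ℕ) (h : ℝ → ℂ) (ε ε' : ℝ) (y : ℝ → ℂ) : Prop where
  smooth : ContDiffOn ℝ ((q + k : ℕ) : WithTop ℕ∞) y (Ioo ε 1)
  ode : ∀ t ∈ Ioo (0 : ℝ) (1 - ε), odeLHS q k h t = odeRHS q k y t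
  init : ∀ i < q + k, iteratedDeriv i y (1 - ε') = 0

end SphericalMean

end

noncomputable section

namespace SphericalMean

/-! The oddness of `n = 2k + 3` makes the zonal weight `(1 - s²)^k` a polynomial, so the relation
between `h` and the coefficients of `f` is a Volterra integral whose kernel is a polynomial in
`cosAngle r t`. Such a kernel is destroyed by finitely many applications of `D`, and what remains is
a differential equation.

The integral formula is `dataH_eq_kern`. For a radial profile `Ψ`, integrate `f(x) Ψ(|x - p|) conj
Y(p)` over `x` and `p`. Polar coordinates about `p` produce `h`; polar coordinates about the origin
and the Funk–Hecke formula (`funkHecke`) produce the zonal integral. Since `Ψ` is arbitrary, the two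
densities agree. Funk–Hecke itself comes from comparing moments: the sphere integrals of `⟨x,y⟩^m
P(y)`, with `P` harmonic, and the moments of `zonalPoly` obey the same recursion in `m`; Weierstrass
approximation does the rest.

By Rodrigues, `zonalPoly k q` is a constant times the `q`-th derivative of `(1 - X²)^N`, where `N =
q + k`. Since `D` in `t` maps `cosAngle r t` to `-1/r`, each `D` differentiates the polynomial once
more and adds a boundary term at `r = 1 - t`, where the cosine is `1`. The first `k` boundary terms
vanish, because `(1 - X²)^N` has a zero of order `N` at `1`. After `N + 1` further steps the
integral vanishes, because the degree is `2N`. As `d/dt = t D`, the left side of the equation is a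
sum of derivatives of boundary terms (`iterate_opD_kernSeq_top`). Expanding `D^l (φ/t)` with Bessel
coefficients and then applying Leibniz gives the stated triple sum (`odeLHS_kernSeq`).

For uniqueness, the leading coefficient has no zero on `(0,1)`, so the linear Cauchy problem has at
most one solution (`linear_ode_unique`). The wanted coefficient vanishes near `1 - ε'`, hence
satisfies the zero initial conditions. -/

instance (n : ℕ) : IsFiniteMeasure (surf n) := by unfold surf; infer_instance

/-! ### Polar coordinates. -/

theorem integral_polar {n : ℕ} (hn : n ≠ 0) {F : Eucl n → ℂ} (hF : Integrable F) :
    ∫ x, F x = ∫ r in Ioi (0 : ℝ), r ^ (n - 1) • ∫ θ : USphere n, F (r • (θ : Eucl n)) ∂(surf n) := by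
  have : Nonempty (Fin n) := ⟨⟨0, Nat.pos_of_ne_zero hn⟩⟩
  have hmp := (volume : Measure (Eucl n)).measurePreserving_homeomorphUnitSphereProd
  have hemb := (homeomorphUnitSphereProd (Eucl n)).measurableEmbedding
  have hdim : Module.finrank ℝ (Eucl n) = n := by simp
  rw [hdim] at hmp
  set G : USphere n × Ioi (0 : ℝ) → ℂ := fun z => F (z.2.1 • (z.1 : Eucl n)) with hG
  have hGc : ∀ x : ({0}ᶜ : Set (Eucl n)), G (homeomorphUnitSphereProd (Eucl n) x) = F x := by
    intro x
    have := homeomorphUnitSphereProd_symm_apply_coe (Eucl n) (homeomorphUnitSphereProd (Eucl n) x)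
    rw [Homeomorph.symm_apply_apply] at this
    simp only [hG]
    rw [← this]
  have hGint : Integrable G ((surf n).prod (Measure.volumeIoiPow (n - 1))) := by
    unfold surf
    rw [← hmp.integrable_comp_emb hemb]
    have : G ∘ (homeomorphUnitSphereProd (Eucl n)) = F ∘ Subtype.val := funext hGc
    rw [this, ← integrableOn_iff_comap_subtypeVal (by measurability)]
    exact hF.integrableOn
  calc ∫ x, F x = ∫ x : ({0}ᶜ : Set (Eucl n)), F x.1 ∂(Measure.comap Subtype.val volume) := by
        rw [integral_subtype_comap (measurableSet_singleton _).compl F,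
          restrict_compl_singleton]
    _ = ∫ z, G z ∂((surf n).prod (Measure.volumeIoiPow (n - 1))) := by
        unfold surf
        rw [← hmp.integral_comp hemb]
        exact integral_congr_ae (.of_forall fun x => (hGc x).symm)
    _ = ∫ r, ∫ θ, G (θ, r) ∂(surf n) ∂(Measure.volumeIoiPow (n - 1)) := integral_prod_symm _ hGint
    _ = _ := by
        simp only [Measure.volumeIoiPow, ENNReal.ofReal]
        rw [integral_withDensity_eq_integral_smul]
        · rw [integral_subtype_comap measurableSet_Ioi
            fun a : ℝ ↦ Real.toNNReal (a ^ (n - 1)) • ∫ θ : USphere n, F (a • (θ : Eucl n)) ∂(surf n)]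
          refine setIntegral_congr_fun measurableSet_Ioi fun x hx ↦ ?_
          rw [NNReal.smul_def, Real.coe_toNNReal _ (pow_nonneg (le_of_lt hx) _)]
        · exact (measurable_subtype_coe.pow_const _).real_toNNReal

/-! ### Smooth dependence on a parameter; smoothness of the coefficients. -/

section Parametric

variable {X E : Type*} [TopologicalSpace X] [CompactSpace X] [MeasurableSpace X]
  [OpensMeasurableSpace X] [NormedAddCommGroup E] [NormedSpace ℝ E]
  {μ : Measure X} [IsFiniteMeasure μ]

theorem hasDerivAt_integral_of_contDiff {G : E × ℝ → ℂ} (hG : ContDiff ℝ ∞ G) {φ : X → E}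
    (hφ : Continuous φ) {c : X → ℂ} (hc : Continuous c) (t : ℝ) :
    HasDerivAt (fun t => ∫ x, G (φ x, t) * c x ∂μ)
      (∫ x, fderiv ℝ G (φ x, t) (0, 1) * c x ∂μ) t := by
  have hG' : Continuous (fderiv ℝ G) := hG.continuous_fderiv (by simp)
  have hcont : Continuous (fun z : X × ℝ => fderiv ℝ G (φ z.1, z.2) (0, 1) * c z.1) := by fun_prop
  obtain ⟨C, hC⟩ := ((isCompact_univ (X := X)).prod
    (isCompact_closedBall t 1)).exists_bound_of_continuousOn hcont.continuousOn
  have hGc := hG.continuous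
  refine (hasDerivAt_integral_of_dominated_loc_of_deriv_le (bound := fun _ => C)
    (F := fun t x => G (φ x, t) * c x)
    (F' := fun t x => fderiv ℝ G (φ x, t) (0, 1) * c x) (closedBall_mem_nhds t one_pos)
    (.of_forall fun s => ?_) ?_ ?_ (.of_forall fun x s hs => hC (x, s) ⟨mem_univ _, hs⟩)
    (integrable_const C) (.of_forall fun x s _ => ?_)).2
  · exact Continuous.aestronglyMeasurable (by fun_prop)
  · have h0 : Continuous fun x => G (φ x, t) * c x := by fun_prop
    exact h0.integrable_of_hasCompactSupport (HasCompactSupport.of_compactSpace _)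
  · exact Continuous.aestronglyMeasurable (by fun_prop)
  · have h1 : HasFDerivAt G (fderiv ℝ G (φ x, s)) (φ x, s) :=
      (hG.differentiable (by simp)).differentiableAt.hasFDerivAt
    have h2 : HasDerivAt (fun s : ℝ => (φ x, s)) ((0 : E), (1 : ℝ)) s :=
      (hasDerivAt_const s (φ x)).prodMk (hasDerivAt_id s)
    exact (h1.comp_hasDerivAt s h2).mul_const (c x)

/-- The derivative in `t` is an integral of the same form, with `G` replaced by its partial
derivative; hence the induction over all `G`. -/
theorem contDiff_integral_of_contDiff {G : E × ℝ → ℂ} (hG : ContDiff ℝ ∞ G) {φ : X → E}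
    (hφ : Continuous φ) {c : X → ℂ} (hc : Continuous c) :
    ContDiff ℝ ∞ (fun t => ∫ x, G (φ x, t) * c x ∂μ) := by
  rw [contDiff_infty]
  intro m
  induction m generalizing G with
  | zero =>
    refine contDiff_zero.2 (continuous_iff_continuousAt.2 fun t =>
      (hasDerivAt_integral_of_contDiff hG hφ hc t).continuousAt)
  | succ m ih =>
    push_cast
    rw [contDiff_succ_iff_deriv]
    refine ⟨fun t => (hasDerivAt_integral_of_contDiff hG hφ hc t).differentiableAt, by simp, ?_⟩
    have : deriv (fun t => ∫ x, G (φ x, t) * c x ∂μ)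
        = fun t => ∫ x, fderiv ℝ G (φ x, t) (0, 1) * c x ∂μ :=
      funext fun t => (hasDerivAt_integral_of_contDiff hG hφ hc t).deriv
    rw [this]
    exact ih (G := fun z => fderiv ℝ G z (0, 1))
      ((hG.fderiv_right (m := ∞) (by simp)).clm_apply contDiff_const)

end Parametric

theorem IsSphericalHarmonic.continuous {n q : ℕ} {Y : USphere n → ℂ}
    (hY : IsSphericalHarmonic n q Y) : Continuous Y := by
  obtain ⟨P, -, -, h⟩ := hY
  rw [funext h]
  refine (MvPolynomial.continuous_eval P).comp ?_
  fun_prop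

theorem contDiff_coeffF {n : ℕ} {f : Eucl n → ℂ} (hf : ContDiff ℝ ∞ f) {Y : USphere n → ℂ}
    (hY : Continuous Y) : ContDiff ℝ ∞ (coeffF n f Y) := by
  have hG : ContDiff ℝ ∞ (fun z : Eucl n × ℝ => f (z.2 • z.1)) :=
    hf.comp (contDiff_snd.smul contDiff_fst)
  exact contDiff_integral_of_contDiff (μ := surf n) hG (φ := fun θ : USphere n => (θ : Eucl n))
    (by fun_prop) (c := fun θ => starRingEnd ℂ (Y θ)) (Complex.continuous_conj.comp hY)

theorem contDiff_coeffG {n : ℕ} {f : Eucl n → ℂ} (hf : ContDiff ℝ ∞ f) {Y : USphere n → ℂ}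
    (hY : Continuous Y) : ContDiff ℝ ∞ (coeffG n f Y) := by
  have hG : ContDiff ℝ ∞ (fun z : (Eucl n × Eucl n) × ℝ => f (z.1.1 + z.2 • z.1.2)) :=
    hf.comp (contDiff_fst.fst.add (contDiff_snd.smul contDiff_fst.snd))
  -- The two sphere integrals are merged into one over the product, which is again a compact
  -- parameter space.
  have key := contDiff_integral_of_contDiff (μ := (surf n).prod (surf n)) hG
    (φ := fun z : USphere n × USphere n => ((z.1 : Eucl n), (z.2 : Eucl n)))
    (by fun_prop) (c := fun z => ((1 / omega (n - 1) : ℝ) : ℂ) * starRingEnd ℂ (Y z.1))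
    (by have := Complex.continuous_conj.comp hY; simp only [Function.comp_def] at this; fun_prop)
  convert key using 2 with t
  have hfc := hf.continuous
  have hYc : Continuous fun z : USphere n × USphere n => starRingEnd ℂ (Y z.1) :=
    Complex.continuous_conj.comp (hY.comp continuous_fst)
  rw [integral_prod]
  · refine integral_congr_ae (.of_forall fun p => ?_)
    simp only [sphericalMean]
    rw [integral_mul_const]
    ring
  · exact Continuous.integrable_of_hasCompactSupport (by fun_prop)
      (HasCompactSupport.of_compactSpace _)

theorem contDiff_dataH {n k : ℕ} {f : Eucl n → ℂ} (hf : ContDiff ℝ ∞ f) {Y : USphere n → ℂ}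
    (hY : Continuous Y) : ContDiff ℝ ∞ (dataH n k f Y) := by
  unfold dataH
  refine ContDiff.mul ?_ (contDiff_coeffG hf hY)
  exact Complex.ofRealCLM.contDiff.comp
    (ContDiff.div_const (contDiff_const.mul (contDiff_id.pow _)) _)

theorem contDiffOn_coeffFTilde {n q : ℕ} {f : Eucl n → ℂ} (hf : ContDiff ℝ ∞ f) {Y : USphere n → ℂ}
    (hY : Continuous Y) : ContDiffOn ℝ ∞ (coeffFTilde n q f Y) (Ioi 0) := by
  unfold coeffFTilde
  simp only [div_eq_mul_inv]
  refine (contDiff_coeffF hf hY).contDiffOn.mul (ContDiffOn.inv ?_ fun t ht => ?_)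
  · exact (Complex.ofRealCLM.contDiff.pow q).contDiffOn
  · exact pow_ne_zero _ (Complex.ofReal_ne_zero.2 (ne_of_gt ht))

/-! ### Integrals of polynomials over the sphere. -/

open MvPolynomial in
/-- The value of a complex polynomial at a point of `ℝⁿ`. -/
def polyEval {n : ℕ} (P : MvPolynomial (Fin n) ℂ) (x : Eucl n) : ℂ :=
  eval (fun i => ((x i : ℝ) : ℂ)) P

/-- The integral of a polynomial over the unit sphere. -/
def sphInt {n : ℕ} (P : MvPolynomial (Fin n) ℂ) : ℂ :=
  ∫ θ : USphere n, polyEval P (θ : Eucl n) ∂(surf n)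

section Poly

variable {n : ℕ}

theorem continuous_polyEval (P : MvPolynomial (Fin n) ℂ) : Continuous (polyEval P) := by
  refine (MvPolynomial.continuous_eval P).comp ?_
  fun_prop

theorem integrable_sphere {g : USphere n → ℂ} (hg : Continuous g) : Integrable g (surf n) :=
  hg.integrable_of_hasCompactSupport (HasCompactSupport.of_compactSpace _)

theorem integrable_polyEval (P : MvPolynomial (Fin n) ℂ) :
    Integrable (fun θ : USphere n => polyEval P (θ : Eucl n)) (surf n) :=
  integrable_sphere ((continuous_polyEval P).comp continuous_subtype_val)

theorem sphInt_add (P Q : MvPolynomial (Fin n) ℂ) : sphInt (P + Q) = sphInt P + sphInt Q := by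
  unfold sphInt
  rw [← integral_add (integrable_polyEval P) (integrable_polyEval Q)]
  simp [polyEval]

theorem sphInt_C_mul (a : ℂ) (P : MvPolynomial (Fin n) ℂ) :
    sphInt (MvPolynomial.C a * P) = a * sphInt P := by
  unfold sphInt
  rw [← integral_const_mul]
  simp [polyEval]

theorem sphInt_sum {ι : Type*} (s : Finset ι) (P : ι → MvPolynomial (Fin n) ℂ) :
    sphInt (∑ i ∈ s, P i) = ∑ i ∈ s, sphInt (P i) := by
  unfold sphInt
  rw [← integral_finsetSum _ fun i _ => integrable_polyEval (P i)]
  simp [polyEval]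

theorem polyEval_smul {P : MvPolynomial (Fin n) ℂ} {d : ℕ} (hP : P.IsHomogeneous d) (r : ℝ)
    (x : Eucl n) : polyEval P (r • x) = (r : ℂ) ^ d * polyEval P x := by
  unfold polyEval
  rw [MvPolynomial.eval_eq', MvPolynomial.eval_eq', Finset.mul_sum]
  refine Finset.sum_congr rfl fun m hm => ?_
  have hd : ∑ i, m i = d := by
    have := hP (MvPolynomial.mem_support_iff.1 hm)
    rwa [Finsupp.weight_apply, Finsupp.sum_fintype _ _ (by simp), Finset.sum_congr rfl
      (g := fun i => m i) (by simp)] at this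
  have : ∏ i, (((r • x) i : ℝ) : ℂ) ^ m i = (r : ℂ) ^ d * ∏ i, ((x i : ℝ) : ℂ) ^ m i := by
    rw [← hd, ← Finset.prod_pow_eq_pow_sum, ← Finset.prod_mul_distrib]
    simp [mul_pow]
  rw [this]
  ring

theorem hasLineDerivAt_polyEval (P : MvPolynomial (Fin n) ℂ) (i : Fin n) (x : Eucl n) :
    HasLineDerivAt ℝ (polyEval P) (polyEval (MvPolynomial.pderiv i P) x) x
      (EuclideanSpace.single i (1 : ℝ)) := by
  unfold HasLineDerivAt
  induction P using MvPolynomial.induction_on with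
  | C a => simpa [polyEval] using hasDerivAt_const (0 : ℝ) a
  | add P Q hP hQ => 
    have h := hP.fun_add hQ
    simp only [polyEval, map_add] at h ⊢
    exact h
  | mul_X P j hP =>
    have hX : HasDerivAt (fun t : ℝ => (((x + t • EuclideanSpace.single i (1 : ℝ)) j : ℝ) : ℂ))
        (if j = i then 1 else 0) 0 := by
      have h1 : HasDerivAt (fun t : ℝ => ((x + t • EuclideanSpace.single i (1 : ℝ)) j : ℝ))
          (if j = i then 1 else 0) 0 := by
        have := ((hasDerivAt_id (0 : ℝ)).mul_const
          ((EuclideanSpace.single i (1 : ℝ) : Eucl n) j)).const_add (x j)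
        simpa [Pi.single_apply] using this
      have := h1.ofReal_comp
      split_ifs at this ⊢ <;> simpa using this
    have h := hP.fun_mul hX
    simp only [polyEval, map_mul, MvPolynomial.eval_X] at h ⊢
    refine h.congr_deriv ?_
    by_cases hij : j = i
    · subst hij; simp; ring
    · simp [MvPolynomial.pderiv_X_of_ne hij, hij]; ring

/-- Homogeneity separates the variables in polar coordinates. This carries identities between volume
integrals over to the sphere. -/
theorem integral_polyEval_mul_radial {P : MvPolynomial (Fin n) ℂ} {d : ℕ} (hn : n ≠ 0)
    (hP : P.IsHomogeneous d) {χ : ℝ → ℝ} (hχ : Continuous χ) (hχc : HasCompactSupport χ) :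
    Integrable (fun y : Eucl n => polyEval P y * ((χ (‖y‖ ^ 2) : ℝ) : ℂ)) ∧
    ∫ y : Eucl n, polyEval P y * ((χ (‖y‖ ^ 2) : ℝ) : ℂ) =
      sphInt P * ((∫ r in Ioi (0 : ℝ), r ^ (d + (n - 1)) * χ (r ^ 2) : ℝ) : ℂ) := by
  have hint : Integrable (fun y : Eucl n => polyEval P y * ((χ (‖y‖ ^ 2) : ℝ) : ℂ)) := by
    refine Continuous.integrable_of_hasCompactSupport ?_ ?_
    · have := continuous_polyEval P
      fun_prop
    · refine HasCompactSupport.mul_left ?_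
      obtain ⟨R, hR⟩ := hχc.isCompact.isBounded.subset_closedBall 0
      refine HasCompactSupport.intro (isCompact_closedBall (0 : Eucl n) (R + 1)) fun y hy => ?_
      have hy' : R + 1 < ‖y‖ := by simpa using hy
      have : ‖y‖ ^ 2 ∉ tsupport χ := fun h => by
        have := hR h
        have h2 : ‖y‖ ^ 2 ≤ R := by simpa [abs_of_nonneg (sq_nonneg ‖y‖)] using this
        nlinarith [sq_nonneg (‖y‖ - 1)]
      rw [image_eq_zero_of_notMem_tsupport this, Complex.ofReal_zero]
  refine ⟨hint, ?_⟩
  rw [integral_polar hn hint, ← integral_complex_ofReal, ← integral_const_mul]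
  refine setIntegral_congr_fun measurableSet_Ioi fun r hr => ?_
  have hr0 : (0 : ℝ) < r := hr
  have h1 : ∀ θ : USphere n, ‖r • (θ : Eucl n)‖ = r := fun θ => by
    rw [norm_smul, norm_eq_of_mem_sphere θ, mul_one, Real.norm_of_nonneg hr0.le]
  simp only [polyEval_smul hP, h1]
  rw [integral_mul_const, integral_const_mul, ← sphInt]
  simp only [Complex.real_smul]
  push_cast
  ring

/-- Integration by parts on the sphere, for homogeneous polynomials. -/
theorem sphInt_X_mul {P : MvPolynomial (Fin n) ℂ} {d : ℕ} (hn : 2 ≤ n)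
    (hP : P.IsHomogeneous d) (i : Fin n) :
    (n + d - 1 : ℂ) * sphInt (MvPolynomial.X i * P) = sphInt (MvPolynomial.pderiv i P) := by
  classical
  -- The integral of `∂ᵢ(P(y) χ(|y|²))` over the whole space is zero. In polar coordinates its two
  -- terms become the two sphere integrals, with radial factors `J` (from `χ`) and `J'` (from
  -- `2χ'`).
  let χ : ContDiffBump (0 : ℝ) := ⟨1, 2, one_pos, one_lt_two⟩
  have hχ : ContDiff ℝ ∞ χ := χ.contDiff
  have hχ' : Continuous (deriv χ) := hχ.continuous_deriv (by simp)
  have hχc : HasCompactSupport χ := χ.hasCompactSupport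
  have hχ2 : Continuous fun s => 2 * deriv χ s := continuous_const.mul hχ'
  have hχ2c : HasCompactSupport fun s => 2 * deriv χ s := hχc.deriv.mul_left
  have hn0 : n ≠ 0 := by omega
  set e := d + (n - 1) with he
  set J := ∫ r in Ioi (0 : ℝ), r ^ (e - 1) * χ (r ^ 2) with hJ
  set J' := ∫ r in Ioi (0 : ℝ), r ^ (e + 1) * (2 * deriv χ (r ^ 2)) with hJ'
  have hcs : ∀ m : ℕ, ∀ g : ℝ → ℝ, HasCompactSupport g →
      HasCompactSupport fun r : ℝ => r ^ m * g (r ^ 2) := fun m g hg => by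
    refine HasCompactSupport.mul_left ?_
    obtain ⟨R, hR⟩ := hg.isCompact.isBounded.subset_closedBall 0
    refine HasCompactSupport.intro (isCompact_closedBall (0 : ℝ) (R + 1)) fun y hy => ?_
    have hy' : R + 1 < |y| := by simpa using hy
    refine image_eq_zero_of_notMem_tsupport fun h => ?_
    have h2 : y ^ 2 ≤ R := by simpa [abs_of_nonneg (sq_nonneg y)] using hR h
    rw [← sq_abs] at h2
    nlinarith [sq_nonneg (|y| - 1)]
  -- This is the integral over `(0,∞)` of the derivative of `r^e χ(r²)`; the value at `0` vanishes
  -- because `n ≥ 2` forces `e ≥ 1`.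
  have hrel : (e : ℝ) * J + J' = 0 := by
    have h1 := (hcs e χ hχc).integral_Ioi_deriv_eq
      (f := fun r : ℝ => r ^ e * χ (r ^ 2)) ((contDiff_id.pow e).mul
        ((hχ.of_le (by simp)).comp (contDiff_id.pow 2))) 0
    have he0 : e ≠ 0 := by omega
    simp only [zero_pow he0, zero_mul, neg_zero] at h1
    rw [hJ, hJ', ← integral_const_mul, ← integral_add]
    · refine Eq.trans ?_ h1
      refine integral_congr_ae (.of_forall fun r => ?_)
      have h2 : HasDerivAt (fun r : ℝ => χ (r ^ 2)) (deriv χ (r ^ 2) * (2 * r)) r := by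
        have h3 : HasDerivAt χ (deriv χ (r ^ 2)) (r ^ 2) :=
          ((hχ.differentiable (by simp)) _).hasDerivAt
        exact (HasDerivAt.comp (h₂ := χ) (h := fun x : ℝ => x ^ 2) r h3
          (hasDerivAt_pow 2 r)).congr_deriv (by simp)
      have h4 := ((hasDerivAt_pow e r).mul h2).deriv
      simp only [Pi.mul_def] at h4
      rw [h4]
      ring
    · refine (Continuous.integrable_of_hasCompactSupport ?_ ?_).integrableOn
      · have := hχ.continuous
        fun_prop
      · exact (hcs (e - 1) χ hχc).mul_left
    · refine (Continuous.integrable_of_hasCompactSupport ?_ ?_).integrableOn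
      · fun_prop
      · exact hcs (e + 1) (fun s => 2 * deriv χ s) hχ2c
  have hJpos : 0 < J := by
    rw [hJ, setIntegral_pos_iff_support_of_nonneg_ae]
    · refine lt_of_lt_of_le ?_ (measure_mono (s := Ioo 0 1) fun r hr => ⟨?_, hr.1⟩)
      · simp
      · have : χ (r ^ 2) = 1 := χ.one_of_mem_closedBall (by
          simp only [mem_closedBall, dist_zero_right, Real.norm_eq_abs, abs_of_nonneg (sq_nonneg r)]
          show r ^ 2 ≤ 1
          nlinarith [hr.1, hr.2])
        simp only [Function.mem_support, this, mul_one]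
        exact pow_ne_zero _ hr.1.ne'
    · filter_upwards [ae_restrict_mem measurableSet_Ioi] with r hr
      exact mul_nonneg (pow_nonneg (le_of_lt hr) _) χ.nonneg
    · refine (Continuous.integrable_of_hasCompactSupport ?_ (hcs (e - 1) χ hχc)).integrableOn
      have := hχ.continuous
      fun_prop
  have hXP : (MvPolynomial.X i * P).IsHomogeneous (d + 1) := by
    rw [add_comm]; exact (MvPolynomial.isHomogeneous_X ℂ i).mul hP
  obtain ⟨I1, E1⟩ := integral_polyEval_mul_radial hn0 hP χ.continuous hχc
  obtain ⟨I2, E2⟩ := integral_polyEval_mul_radial hn0 hXP hχ2 hχ2c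
  have hE2 : d + 1 + (n - 1) = e + 1 := by omega
  rw [hE2, ← hJ'] at E2
  have E3 : Integrable (fun y : Eucl n => polyEval (MvPolynomial.pderiv i P) y *
      ((χ (‖y‖ ^ 2) : ℝ) : ℂ)) ∧ ∫ y : Eucl n, polyEval (MvPolynomial.pderiv i P) y *
      ((χ (‖y‖ ^ 2) : ℝ) : ℂ) = sphInt (MvPolynomial.pderiv i P) * (J : ℂ) := by
    -- For `d = 0` the truncated `d - 1` would give the wrong radial exponent, but then `∂ᵢP = 0`.
    rcases Nat.eq_zero_or_pos d with rfl | hd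
    · have : MvPolynomial.pderiv i P = 0 := by
        rw [← MvPolynomial.totalDegree_zero_iff_isHomogeneous,
          MvPolynomial.totalDegree_eq_zero_iff_eq_C] at hP
        rw [hP, MvPolynomial.pderiv_C]
      simp [this, polyEval, sphInt]
    · have h := integral_polyEval_mul_radial hn0 (hP.pderiv (i := i)) χ.continuous hχc
      rwa [show d - 1 + (n - 1) = e - 1 by omega, ← hJ] at h
  have hXeq : (fun y : Eucl n => polyEval (MvPolynomial.X i * P) y *
      ((2 * deriv χ (‖y‖ ^ 2) : ℝ) : ℂ)) = fun y => polyEval P y *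
      ((deriv χ (‖y‖ ^ 2) * (2 * y i) : ℝ) : ℂ) := by
    funext y; simp [polyEval]; ring
  rw [hXeq] at I2 E2
  have key := integral_bilinear_hasLineDerivAt_right_eq_neg_left_of_integrable
    (μ := (volume : Measure (Eucl n))) (B := ContinuousLinearMap.mul ℝ ℂ)
    (f := polyEval P) (f' := polyEval (MvPolynomial.pderiv i P))
    (g := fun y => ((χ (‖y‖ ^ 2) : ℝ) : ℂ))
    (g' := fun y => ((deriv χ (‖y‖ ^ 2) * (2 * y i) : ℝ) : ℂ))
    (v := EuclideanSpace.single i (1 : ℝ)) E3.1 I2 I1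
    (fun x _ => hasLineDerivAt_polyEval P i x) (fun x _ => by
      unfold HasLineDerivAt
      have h1 : HasDerivAt (fun t : ℝ => x + t • (EuclideanSpace.single i (1 : ℝ) : Eucl n))
          (EuclideanSpace.single i (1 : ℝ)) 0 := by
        simpa using ((hasDerivAt_id (0 : ℝ)).smul_const
          (EuclideanSpace.single i (1 : ℝ) : Eucl n)).const_add x
      have h2 := h1.norm_sq
      have h3 : HasDerivAt χ (deriv χ (‖x‖ ^ 2))
          (‖x + (0 : ℝ) • (EuclideanSpace.single i (1 : ℝ) : Eucl n)‖ ^ 2) := by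
        simpa using ((hχ.differentiable (by simp)) (‖x‖ ^ 2)).hasDerivAt
      have h4 := (h3.comp 0 h2).ofReal_comp
      exact h4.congr_deriv (by simp [EuclideanSpace.inner_single_right]))
  change ∫ y : Eucl n, polyEval P y * ((deriv χ (‖y‖ ^ 2) * (2 * y i) : ℝ) : ℂ) =
    -∫ y : Eucl n, polyEval (MvPolynomial.pderiv i P) y * ((χ (‖y‖ ^ 2) : ℝ) : ℂ) at key
  rw [E2, E3.2] at key
  have hJ0 : (J : ℂ) ≠ 0 := Complex.ofReal_ne_zero.2 hJpos.ne'
  have hrel' : (J' : ℂ) = -((n + d - 1 : ℂ) * J) := by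
    have : (e : ℝ) = n + d - 1 := by
      rw [he]; push_cast [Nat.cast_sub (show 1 ≤ n by omega)]; ring
    rw [this] at hrel
    rw [show J' = -((n + d - 1 : ℝ) * J) by linarith]
    push_cast; ring
  rw [hrel'] at key
  apply mul_right_cancel₀ hJ0
  linear_combination -key

end Poly

/-! ### Gegenbauer weights by the Rodrigues formula, and their moments. -/

section Gegenbauer

open Polynomial

theorem iterate_derivative_succ_X_mul (f : ℝ[X]) (p : ℕ) :
    derivative^[p + 1] (X * f) = X * derivative^[p + 1] f + (p + 1 : ℝ[X]) * derivative^[p] f := by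
  induction p with
  | zero => simp; ring
  | succ p ih =>
    rw [Function.iterate_succ_apply', ih]
    simp only [derivative_add, derivative_mul, derivative_X, derivative_natCast, derivative_one,
      ← Function.iterate_succ_apply' (⇑derivative)]
    push_cast
    ring

/-- The polynomial `(1 - X²)^N`. -/
def bumpPoly (N : ℕ) : ℝ[X] := (1 - X ^ 2) ^ N

theorem derivative_bumpPoly_succ (N : ℕ) :
    derivative (bumpPoly (N + 1)) = C (-(2 * (N + 1 : ℝ))) * (X * bumpPoly N) := by
  simp only [bumpPoly, derivative_pow_succ, derivative_sub, derivative_one,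
    derivative_X]
  simp only [map_neg, map_mul, map_add, map_one, map_natCast, map_ofNat]
  push_cast
  ring

theorem bumpPoly_ode (N : ℕ) :
    (1 - X ^ 2) * derivative (bumpPoly N) + (2 * N : ℝ[X]) * (X * bumpPoly N) = 0 := by
  cases N with
  | zero => simp [bumpPoly]
  | succ N =>
    rw [derivative_bumpPoly_succ]
    simp only [bumpPoly, pow_succ (1 - X ^ 2 : ℝ[X])]
    simp only [map_neg, map_mul, map_add, map_one, map_natCast, map_ofNat]
    push_cast
    ring

/-- A factor `(1 - X²)^(N - j)` survives `j` differentiations. This removes boundary terms both in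
the moments and in the first applications of `D`. -/
theorem eval_iterate_derivative_bumpPoly {N j : ℕ} (h : j < N) {s : ℝ} (hs : s ^ 2 = 1) :
    (derivative^[j] (bumpPoly N)).eval s = 0 := by
  obtain ⟨Q, hQ⟩ := pow_sub_dvd_iterate_derivative_pow (1 - X ^ 2 : ℝ[X]) N j
  rw [bumpPoly, hQ, eval_mul, eval_pow]
  simp [hs, zero_pow (Nat.sub_ne_zero_of_lt h)]

/-- The product of the Gegenbauer weight `(1 - s²)^k` and the normalized Gegenbauer polynomial of
degree `q`, in the form given by the Rodrigues formula. -/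
def zonalPoly (k q : ℕ) : ℝ[X] :=
  C ((-1) ^ q * (k.factorial : ℝ) / (2 ^ q * (q + k).factorial)) * derivative^[q] (bumpPoly (q + k))

theorem zonalPoly_zero (k : ℕ) : zonalPoly k 0 = bumpPoly k := by
  have : (k.factorial : ℝ) ≠ 0 := by positivity
  simp [zonalPoly, this]

/-- Spending one derivative on the power expresses degree `p + 1` through the same `bumpPoly (p +
k)`, and with the same constant, as degree `p`. -/
theorem zonalPoly_succ (k p : ℕ) : zonalPoly k (p + 1) =
    C ((-1) ^ p * (k.factorial : ℝ) / (2 ^ p * (p + k).factorial)) *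
      derivative^[p] (X * bumpPoly (p + k)) := by
  have h : p + 1 + k = p + k + 1 := by ring
  rw [zonalPoly, h, Function.iterate_succ_apply, derivative_bumpPoly_succ,
    iterate_derivative_C_mul, ← mul_assoc, ← C_mul]
  congr 2
  have : ((p + k).factorial : ℝ) ≠ 0 := by positivity
  rw [Nat.factorial_succ]
  push_cast
  have : (p + k + 1 : ℝ) ≠ 0 := by positivity
  field_simp
  ring

/-- After removing the common constant, this is `X` times the `p`-fold derivative of `bumpPoly_ode`,
where `q = p + 1`. For `q = 0` the factor `q` makes the truncated `q - 1` harmless. -/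
theorem zonalPoly_recurrence (k q : ℕ) :
    (1 - X ^ 2) * derivative (zonalPoly k q) + (2 * k + q : ℝ[X]) * (X * zonalPoly k q) =
      (q : ℝ[X]) * zonalPoly k (q - 1) := by
  rcases q with _ | p
  · rw [zonalPoly_zero]
    simpa using bumpPoly_ode k
  · rw [zonalPoly_succ, Nat.add_sub_cancel, zonalPoly]
    set a := C ((-1) ^ p * (k.factorial : ℝ) / (2 ^ p * (p + k).factorial))
    set v := bumpPoly (p + k) with hv
    rw [derivative_C_mul]
    suffices h : (1 - X ^ 2) * derivative (derivative^[p] (X * v)) +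
        (2 * k + (p + 1 : ℕ) : ℝ[X]) * (X * derivative^[p] (X * v)) =
        ((p + 1 : ℕ) : ℝ[X]) * derivative^[p] v by
      linear_combination a * h
    have hode := bumpPoly_ode (p + k)
    rw [← hv] at hode
    rcases p with _ | p
    · simp only [Function.iterate_zero, id_eq, derivative_mul, derivative_X, one_mul]
      push_cast at hode ⊢
      linear_combination X * hode
    · have h1 : derivative^[p + 1] ((1 - X ^ 2) * derivative v +
          (2 * (p + 1 + k : ℕ) : ℝ[X]) * (X * v)) = 0 := by rw [hode]; simp
      have h2 : (1 - X ^ 2) * derivative v + (2 * (p + 1 + k : ℕ) : ℝ[X]) * (X * v) =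
          derivative v - X * (X * derivative v) +
            C (2 * (p + 1 + k : ℕ) : ℝ) * (X * v) := by
        simp only [map_mul, map_natCast, map_ofNat]; ring
      have h3 : derivative^[p] (X * derivative v) =
          X * derivative^[p + 1] v + (p : ℝ[X]) * derivative^[p] v := by
        rcases p with _ | p
        · simp
        · rw [iterate_derivative_succ_X_mul, ← Function.iterate_succ_apply,
            ← Function.iterate_succ_apply]
          push_cast
          ring
      rw [h2, iterate_map_add, iterate_map_sub, iterate_derivative_C_mul,
        iterate_derivative_succ_X_mul, iterate_derivative_succ_X_mul, h3,
        iterate_derivative_succ_X_mul, ← Function.iterate_succ_apply,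
        Function.iterate_succ_apply'] at h1
      rw [iterate_derivative_succ_X_mul]
      simp only [map_mul, map_natCast, map_ofNat,
        ← Function.iterate_succ_apply (⇑derivative) p v] at h1
      simp only [derivative_add, derivative_mul, derivative_X, derivative_natCast, derivative_one]
      rw [← Function.iterate_succ_apply' (⇑derivative) p v]
      push_cast at h1 ⊢
      linear_combination X * h1

/-- Integration of a real polynomial over `[-1, 1]`. -/
def polyInt (P : ℝ[X]) : ℝ := ∫ s in (-1 : ℝ)..1, P.eval s

theorem polyInt_add (P Q : ℝ[X]) : polyInt (P + Q) = polyInt P + polyInt Q := by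
  unfold polyInt
  rw [← intervalIntegral.integral_add (P.continuous.intervalIntegrable _ _)
    (Q.continuous.intervalIntegrable _ _)]
  simp

theorem polyInt_C_mul (a : ℝ) (P : ℝ[X]) : polyInt (C a * P) = a * polyInt P := by
  unfold polyInt
  rw [← intervalIntegral.integral_const_mul]
  simp

theorem polyInt_derivative (P : ℝ[X]) : polyInt (derivative P) = P.eval 1 - P.eval (-1) :=
  intervalIntegral.integral_eq_sub_of_hasDerivAt (fun x _ => P.hasDerivAt x)
    ((derivative P).continuous.intervalIntegrable _ _)

theorem polyInt_bumpPoly (k : ℕ) :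
    polyInt (bumpPoly k) = 2 ^ (k + 1) * k.factorial / (2 * k + 1).doubleFactorial := by
  induction k with
  | zero => simp [polyInt, bumpPoly]; norm_num
  | succ k ih =>
    -- Wallis-type recursion: the total derivative integrates to zero, as `bumpPoly (k + 1)`
    -- vanishes at `±1`.
    have h : derivative (X * bumpPoly (k + 1)) + C (2 * (k + 1 : ℝ)) * bumpPoly k =
        C (2 * k + 3 : ℝ) * bumpPoly (k + 1) := by
      rw [derivative_mul, derivative_bumpPoly_succ]
      simp only [bumpPoly, pow_succ (1 - X ^ 2 : ℝ[X]), derivative_X]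
      simp only [map_neg, map_mul, map_add, map_one, map_natCast, map_ofNat]
      ring
    have h2 := congrArg polyInt h
    rw [polyInt_add, polyInt_derivative, polyInt_C_mul, polyInt_C_mul, ih] at h2
    have e1 : (bumpPoly (k + 1)).eval 1 = 0 := by simp [bumpPoly]
    have e2 : (bumpPoly (k + 1)).eval (-1) = 0 := by simp [bumpPoly]
    simp only [eval_mul, e1, e2, mul_zero, sub_zero, zero_add] at h2
    have h3 : (2 * (k + 1) + 1).doubleFactorial = (2 * k + 3) * (2 * k + 1).doubleFactorial :=
      Nat.doubleFactorial_add_two (2 * k + 1)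
    rw [h3, Nat.factorial_succ]
    have h4 : ((2 * k + 1).doubleFactorial : ℝ) ≠ 0 := by
      exact_mod_cast (Nat.doubleFactorial_pos _).ne'
    have h5 : (2 * k + 3 : ℝ) ≠ 0 := by positivity
    push_cast
    field_simp at h2 ⊢
    linear_combination -h2

theorem omega_pos (d : ℕ) : 0 < omega d := by
  unfold omega surf
  rw [Measure.toSphere_real_apply_univ, measureReal_def]
  have : 0 < (volume (ball (0 : Eucl (d + 1)) 1)).toReal :=
    ENNReal.toReal_pos (measure_ball_pos _ _ one_pos).ne' measure_ball_lt_top.ne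
  simp only [finrank_euclideanSpace, Fintype.card_fin]
  positivity

/-- Obtained from the closed formulas for ball volumes in dimensions `2k + 3` and `2k + 2`. It fixes
the normalization in the degree-zero case of Funk–Hecke. -/
theorem omega_even_eq (k : ℕ) :
    omega (2 * k + 2) = omega (2 * k + 1) * polyInt (bumpPoly k) := by
  rw [polyInt_bumpPoly]
  unfold omega surf
  rw [Measure.toSphere_real_apply_univ, Measure.toSphere_real_apply_univ, measureReal_def,
    measureReal_def, InnerProductSpace.volume_ball_of_dim_odd (k := k + 1) (by simp; ring),
    InnerProductSpace.volume_ball_of_dim_even (k := k + 1) (by simp; ring)]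
  simp only [finrank_euclideanSpace, Fintype.card_fin, ENNReal.ofReal_one, one_pow, one_mul]
  rw [ENNReal.toReal_ofReal (by positivity), ENNReal.toReal_ofReal (by positivity)]
  have h3 : (2 * k + 2 + 1).doubleFactorial = (2 * k + 3) * (2 * k + 1).doubleFactorial :=
    Nat.doubleFactorial_add_two (2 * k + 1)
  rw [h3, Nat.factorial_succ]
  have h4 : ((2 * k + 1).doubleFactorial : ℝ) ≠ 0 := by
    exact_mod_cast (Nat.doubleFactorial_pos _).ne'
  have h5 : (2 * k + 3 : ℝ) ≠ 0 := by positivity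
  push_cast
  field_simp
  ring

theorem polyInt_zonalPoly_zero (k : ℕ) :
    omega (2 * k + 1) * polyInt (zonalPoly k 0) = omega (2 * k + 2) := by
  rw [zonalPoly_zero, omega_even_eq]

theorem polyInt_zonalPoly_succ (k p : ℕ) : polyInt (zonalPoly k (p + 1)) = 0 := by
  rw [zonalPoly, polyInt_C_mul, Function.iterate_succ_apply', polyInt_derivative,
    eval_iterate_derivative_bumpPoly (by omega) (by norm_num),
    eval_iterate_derivative_bumpPoly (by omega) (by norm_num)]
  simp

/-- The moments of the zonal weights. -/
def zonalMoment (k q m : ℕ) : ℝ := polyInt (X ^ m * zonalPoly k q)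

/-- The derivative of `X^m (1 - X²) zonalPoly k q` has integral zero. The recursion is the one of
`sphInt_linForm_pow_succ` for `n = 2k + 3`. -/
theorem zonalMoment_succ (k q m : ℕ) :
    (2 * k + 2 + m + q : ℝ) * zonalMoment k q (m + 1) =
      m * zonalMoment k q (m - 1) + q * zonalMoment k (q - 1) m := by
  have h : C (2 * k + 2 + m + q : ℝ) * (X ^ (m + 1) * zonalPoly k q) =
      C (m : ℝ) * (X ^ (m - 1) * zonalPoly k q) + C (q : ℝ) * (X ^ m * zonalPoly k (q - 1)) +
        C (-1) * derivative (X ^ m * (1 - X ^ 2) * zonalPoly k q) := by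
    have := zonalPoly_recurrence k q
    simp only [derivative_mul, derivative_X_pow, derivative_sub, derivative_one]
    simp only [map_neg, map_mul, map_add, map_one, map_natCast, map_ofNat]
    rcases m with _ | m
    · simp only [pow_zero, Nat.cast_zero]
      push_cast
      linear_combination this
    · simp only [Nat.add_sub_cancel]
      push_cast
      linear_combination X ^ (m + 1) * this
  have h2 := congrArg polyInt h
  rw [polyInt_add, polyInt_add, polyInt_C_mul, polyInt_C_mul, polyInt_C_mul, polyInt_C_mul,
    polyInt_derivative] at h2
  simp only [eval_mul, eval_sub, eval_pow, eval_X, eval_one] at h2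
  unfold zonalMoment
  rw [h2]
  ring

end Gegenbauer

/-! ### The Funk–Hecke formula: moments, then polynomial and continuous kernels. -/

section FunkHecke

open MvPolynomial

variable {n : ℕ}

/-- The linear form `y ↦ ⟨x, y⟩` as a polynomial. -/
def linForm (x : Eucl n) : MvPolynomial (Fin n) ℂ := ∑ i, C ((x i : ℝ) : ℂ) * X i

/-- The derivative of a polynomial in the direction `x`. -/
def dirDeriv (x : Eucl n) (P : MvPolynomial (Fin n) ℂ) : MvPolynomial (Fin n) ℂ :=
  ∑ i, C ((x i : ℝ) : ℂ) * pderiv i P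

/-- The Laplacian of a polynomial. -/
def lap (P : MvPolynomial (Fin n) ℂ) : MvPolynomial (Fin n) ℂ := ∑ i, pderiv i (pderiv i P)

theorem isHomogeneous_linForm (x : Eucl n) : (linForm x).IsHomogeneous 1 :=
  IsHomogeneous.sum _ _ _ fun i _ => by
    simpa using (isHomogeneous_C (Fin n) ((x i : ℝ) : ℂ)).mul (isHomogeneous_X ℂ i)

theorem isHomogeneous_dirDeriv (x : Eucl n) {P : MvPolynomial (Fin n) ℂ} {d : ℕ}
    (hP : P.IsHomogeneous d) : (dirDeriv x P).IsHomogeneous (d - 1) :=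
  IsHomogeneous.sum _ _ _ fun i _ => by
    simpa using (isHomogeneous_C (Fin n) ((x i : ℝ) : ℂ)).mul (hP.pderiv (i := i))

theorem pderiv_linForm (x : Eucl n) (i : Fin n) : pderiv i (linForm x) = C ((x i : ℝ) : ℂ) := by
  classical
  simp [linForm, pderiv_X, Pi.single_apply]

theorem pderiv_comm (i j : Fin n) (P : MvPolynomial (Fin n) ℂ) :
    pderiv i (pderiv j P) = pderiv j (pderiv i P) := by
  classical
  induction P using MvPolynomial.induction_on with
  | C a => simp
  | add P Q hP hQ => simp [hP, hQ]
  | mul_X P l hP =>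
    simp only [pderiv_mul, map_add, hP, pderiv_X, Pi.single_apply]
    split_ifs <;> simp
    ring

theorem lap_dirDeriv (x : Eucl n) {P : MvPolynomial (Fin n) ℂ} (hP : lap P = 0) :
    lap (dirDeriv x P) = 0 := by
  have : lap (dirDeriv x P) = dirDeriv x (lap P) := by
    simp only [lap, dirDeriv, map_sum, pderiv_C_mul, Finset.mul_sum]
    rw [Finset.sum_comm]
    refine Finset.sum_congr rfl fun i _ => Finset.sum_congr rfl fun j _ => ?_
    rw [pderiv_comm j i, pderiv_comm j i]
  rw [this, hP]
  simp [dirDeriv]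

theorem polyEval_dirDeriv_self (x : Eucl n) {P : MvPolynomial (Fin n) ℂ} {d : ℕ}
    (hP : P.IsHomogeneous d) : polyEval (dirDeriv x P) x = d * polyEval P x := by
  have h := congrArg (fun Q => polyEval Q x) hP.sum_X_mul_pderiv
  simpa [polyEval, dirDeriv] using h

theorem sum_coord_sq {x : Eucl n} (hx : ‖x‖ = 1) : ∑ i, ((x i : ℝ) : ℂ) * ((x i : ℝ) : ℂ) = 1 := by
  have h : ‖x‖ ^ 2 = ∑ i, x i ^ 2 := EuclideanSpace.real_norm_sq_eq x
  rw [hx] at h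
  have h2 := congrArg (fun r : ℝ => (r : ℂ)) h
  push_cast at h2
  simpa [sq] using h2.symm

/-- One factor `⟨x,y⟩ = ∑ xᵢ yᵢ` is split off and each `yᵢ` integrated by parts; `|x| = 1` is what
makes the coefficient of the `m - 1` term equal to `m`. -/
theorem sphInt_linForm_pow_succ (hn : 2 ≤ n) {x : Eucl n} (hx : ‖x‖ = 1)
    {P : MvPolynomial (Fin n) ℂ} {q : ℕ} (hP : P.IsHomogeneous q) (m : ℕ) :
    (n + m + q - 1 : ℂ) * sphInt (linForm x ^ (m + 1) * P) =
      m * sphInt (linForm x ^ (m - 1) * P) + sphInt (linForm x ^ m * dirDeriv x P) := by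
  have h1 : linForm x ^ (m + 1) * P =
      ∑ i, C ((x i : ℝ) : ℂ) * (X i * (linForm x ^ m * P)) := by
    rw [pow_succ']
    conv_lhs => rw [linForm]
    rw [mul_assoc, Finset.sum_mul]
    exact Finset.sum_congr rfl fun i _ => by rw [mul_assoc]; rfl
  have hhom : (linForm x ^ m * P).IsHomogeneous (m + q) := by
    simpa using ((isHomogeneous_linForm x).pow m).mul hP
  have h2 : ∑ i, C ((x i : ℝ) : ℂ) * pderiv i (linForm x ^ m * P) =
      C (m : ℂ) * (linForm x ^ (m - 1) * P) + linForm x ^ m * dirDeriv x P := by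
    have : ∀ i, C ((x i : ℝ) : ℂ) * pderiv i (linForm x ^ m * P) =
        C (((x i : ℝ) : ℂ) * ((x i : ℝ) : ℂ)) * (C (m : ℂ) * (linForm x ^ (m - 1) * P)) +
          linForm x ^ m * (C ((x i : ℝ) : ℂ) * pderiv i P) := fun i => by
      rw [pderiv_mul, pderiv_pow, pderiv_linForm, C_mul, map_natCast]; ring
    rw [Finset.sum_congr rfl fun i _ => this i, Finset.sum_add_distrib, ← Finset.sum_mul,
      ← map_sum, sum_coord_sq hx, ← Finset.mul_sum, dirDeriv]
    simp
  rw [h1, sphInt_sum, Finset.mul_sum, ← sphInt_C_mul, ← sphInt_add, ← h2, sphInt_sum]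
  refine Finset.sum_congr rfl fun i _ => ?_
  rw [sphInt_C_mul, sphInt_C_mul, ← sphInt_X_mul hn hhom i]
  push_cast
  ring

/-- In degree zero `P` is constant. In positive degree both sides vanish: Euler's identity and
integration by parts reduce the left side to the integral of the Laplacian of `P`. Hence `x` may be
arbitrary. -/
theorem sphInt_harmonic {k : ℕ} {q : ℕ} {P : MvPolynomial (Fin (2 * k + 3)) ℂ}
    (hP : P.IsHomogeneous q) (hl : lap P = 0) (x : Eucl (2 * k + 3)) :
    sphInt P = ((omega (2 * k + 1) * zonalMoment k q 0 : ℝ) : ℂ) * polyEval P x := by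
  unfold zonalMoment
  rcases q with _ | p
  · rw [← totalDegree_zero_iff_isHomogeneous, totalDegree_eq_zero_iff_eq_C] at hP
    rw [pow_zero, one_mul, polyInt_zonalPoly_zero, hP]
    simp only [sphInt, polyEval, eval_C, integral_const, omega, Complex.real_smul]
  · rw [pow_zero, one_mul, polyInt_zonalPoly_succ]
    have h : ((2 * k + 3 : ℕ) + p - 1 : ℂ) * sphInt ((p + 1) • P) = 0 := by
      rw [← hP.sum_X_mul_pderiv, sphInt_sum, Finset.mul_sum]
      have hd : ∀ i, (pderiv i P).IsHomogeneous p := fun i => hP.pderiv (i := i)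
      rw [Finset.sum_congr rfl fun i _ => sphInt_X_mul (by omega) (hd i) i, ← sphInt_sum]
      change sphInt (lap P) = 0
      rw [hl]
      simp [sphInt, polyEval]
    rw [nsmul_eq_mul, ← map_natCast (C : ℂ →+* MvPolynomial (Fin (2 * k + 3)) ℂ),
      sphInt_C_mul] at h
    have h1 : ((2 * k + 3 : ℕ) + p - 1 : ℂ) ≠ 0 := by
      have : ((2 * k + 3 : ℕ) + p - 1 : ℂ) = ((2 * k + 2 + p : ℕ) : ℂ) := by push_cast; ring
      rw [this]
      exact_mod_cast (by omega : 2 * k + 2 + p ≠ 0)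
    have h2 : ((p + 1 : ℕ) : ℂ) ≠ 0 := by exact_mod_cast Nat.succ_ne_zero p
    rcases mul_eq_zero.1 h with h | h
    · exact absurd h h1
    · rw [(mul_eq_zero.1 h).resolve_left h2]; simp

/-- The derivative of `P` in direction `x` is harmonic of degree `q - 1` and has value `q P(x)` at
`x`, so both sides satisfy the same recursion. It involves `m - 1` as well as `q - 1`: strong
induction on `m`, over all `q` and `P`. -/
theorem sphInt_linForm_pow_mul_harmonic {k : ℕ} {x : Eucl (2 * k + 3)} (hx : ‖x‖ = 1) (m : ℕ)
    {q : ℕ} {P : MvPolynomial (Fin (2 * k + 3)) ℂ} (hP : P.IsHomogeneous q) (hl : lap P = 0) :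
    sphInt (linForm x ^ m * P) =
      ((omega (2 * k + 1) * zonalMoment k q m : ℝ) : ℂ) * polyEval P x := by
  induction m using Nat.strong_induction_on generalizing q P with
  | _ m ih =>
  rcases m with _ | m
  · rw [pow_zero, one_mul]
    exact sphInt_harmonic hP hl x
  · have h := sphInt_linForm_pow_succ (by omega) hx hP m
    rw [ih m (by omega) (isHomogeneous_dirDeriv x hP) (lap_dirDeriv x hl),
      polyEval_dirDeriv_self x hP, ih (m - 1) (by omega) hP hl] at h
    have hT := congrArg (fun r : ℝ => (r : ℂ)) (zonalMoment_succ k q m)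
    push_cast at h hT ⊢
    have h1 : (2 * k + 2 + m + q : ℂ) ≠ 0 := by
      exact_mod_cast (by omega : 2 * k + 2 + m + q ≠ 0)
    apply mul_left_cancel₀ h1
    linear_combination h - omega (2 * k + 1) * polyEval P x * hT

end FunkHecke

section FunkHecke

theorem polyEval_linForm {n : ℕ} (x y : Eucl n) :
    polyEval (linForm x) y = ((inner ℝ x y : ℝ) : ℂ) := by
  simp [polyEval, linForm, PiLp.inner_apply, mul_comm]

theorem continuous_sphere_inner {n : ℕ} (x : USphere n) :
    Continuous fun p : USphere n => inner ℝ (x : Eucl n) (p : Eucl n) := by fun_prop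

theorem funkHecke_polynomial {k q : ℕ} {Y : USphere (2 * k + 3) → ℂ}
    (hY : IsSphericalHarmonic (2 * k + 3) q Y) (x : USphere (2 * k + 3)) (Φ : Polynomial ℝ) :
    ∫ p : USphere (2 * k + 3), ((Φ.eval (inner ℝ (x : Eucl (2 * k + 3)) (p : Eucl _)) : ℝ) : ℂ) * Y p
        ∂(surf (2 * k + 3)) =
      ((omega (2 * k + 1) * polyInt (Φ * zonalPoly k q) : ℝ) : ℂ) * Y x := by
  have hYc := hY.continuous
  have hint : ∀ Φ : Polynomial ℝ, Integrable (fun p : USphere (2 * k + 3) =>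
      ((Φ.eval (inner ℝ (x : Eucl (2 * k + 3)) (p : Eucl _)) : ℝ) : ℂ) * Y p) (surf _) := fun Φ => by
    have h1 := Φ.continuous.comp (continuous_sphere_inner x)
    exact integrable_sphere ((Complex.continuous_ofReal.comp h1).mul hYc)
  induction Φ using Polynomial.induction_on' with
  | add Φ₁ Φ₂ h₁ h₂ =>
    rw [add_mul, polyInt_add, mul_add, Complex.ofReal_add, add_mul, ← h₁, ← h₂,
      ← integral_add (hint Φ₁) (hint Φ₂)]
    simp [add_mul]
  | monomial m a =>
    obtain ⟨P, hP, hl, hPY⟩ := hY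
    have h := sphInt_linForm_pow_mul_harmonic (norm_eq_of_mem_sphere x) m hP hl
    rw [← Polynomial.C_mul_X_pow_eq_monomial, mul_assoc, polyInt_C_mul, hPY x]
    change _ = _ * polyEval P (x : Eucl _)
    rw [mul_left_comm, Complex.ofReal_mul, mul_assoc, ← zonalMoment, ← h, sphInt,
      ← integral_const_mul]
    refine integral_congr_ae (.of_forall fun p => ?_)
    have : polyEval (linForm (x : Eucl (2 * k + 3)) ^ m * P) (p : Eucl _) =
        ((inner ℝ (x : Eucl (2 * k + 3)) (p : Eucl _) : ℝ) : ℂ) ^ m * Y p := by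
      rw [← polyEval_linForm, hPY p]
      simp [polyEval]
    simp only [this]
    simp
    ring

/-- The **Funk–Hecke formula** for continuous zonal kernels in odd dimension. -/
theorem funkHecke {k q : ℕ} {Y : USphere (2 * k + 3) → ℂ}
    (hY : IsSphericalHarmonic (2 * k + 3) q Y) (x : USphere (2 * k + 3)) {Φ : ℝ → ℝ}
    (hΦ : Continuous Φ) :
    ∫ p : USphere (2 * k + 3), ((Φ (inner ℝ (x : Eucl (2 * k + 3)) (p : Eucl _)) : ℝ) : ℂ) * Y p
        ∂(surf (2 * k + 3)) =
      ((omega (2 * k + 1) * ∫ s in (-1 : ℝ)..1, Φ s * (zonalPoly k q).eval s : ℝ) : ℂ) * Y x := by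
  have hYc := hY.continuous
  set W := zonalPoly k q with hW
  set A := ∫ p, ‖Y p‖ ∂(surf (2 * k + 3)) with hA
  set B := ∫ s in (-1 : ℝ)..1, ‖W.eval s‖ with hB
  have hA0 : 0 ≤ A := integral_nonneg fun _ => norm_nonneg _
  have hB0 : 0 ≤ B := intervalIntegral.integral_nonneg (by norm_num) fun _ _ => norm_nonneg _
  have hω := omega_pos (2 * k + 1)
  set C := A + omega (2 * k + 1) * B * ‖Y x‖ with hC
  have hC0 : 0 ≤ C := by positivity
  have hinner : ∀ p : USphere (2 * k + 3),
      inner ℝ (x : Eucl (2 * k + 3)) (p : Eucl _) ∈ Icc (-1 : ℝ) 1 := fun p => by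
    have := abs_real_inner_le_norm (x : Eucl (2 * k + 3)) (p : Eucl _)
    rw [norm_eq_of_mem_sphere, norm_eq_of_mem_sphere, mul_one] at this
    exact abs_le.1 this
  rw [← sub_eq_zero, ← norm_le_zero_iff]
  refine le_of_forall_pos_le_add fun ε hε => ?_
  -- A uniform error `δ` in the kernel changes the two sides by at most `C δ` together; `C + 1`
  -- avoids division by zero.
  obtain ⟨P, hP⟩ := exists_polynomial_near_of_continuousOn (-1) 1 Φ hΦ.continuousOn
    (ε / (C + 1)) (by positivity)
  have hPF := funkHecke_polynomial hY x P
  have h1 : ‖(∫ p : USphere (2 * k + 3),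
      ((Φ (inner ℝ (x : Eucl (2 * k + 3)) (p : Eucl _)) : ℝ) : ℂ) * Y p ∂(surf (2 * k + 3))) -
      ∫ p : USphere (2 * k + 3), ((P.eval (inner ℝ (x : Eucl (2 * k + 3)) (p : Eucl _)) : ℝ) : ℂ) *
        Y p ∂(surf (2 * k + 3))‖ ≤ ε / (C + 1) * A := by
    rw [← integral_sub, hA, ← integral_const_mul]
    · refine norm_integral_le_of_norm_le ((integrable_sphere hYc).norm.const_mul _)
        (.of_forall fun p => ?_)
      rw [← sub_mul, norm_mul, ← Complex.ofReal_sub, Complex.norm_real, Real.norm_eq_abs, abs_sub_comm]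
      gcongr
      exact (hP _ (hinner p)).le
    · exact integrable_sphere ((Complex.continuous_ofReal.comp
        (hΦ.comp (continuous_sphere_inner x))).mul hYc)
    · exact integrable_sphere ((Complex.continuous_ofReal.comp
        (P.continuous.comp (continuous_sphere_inner x))).mul hYc)
  have h2 : ‖polyInt (P * W) - ∫ s in (-1 : ℝ)..1, Φ s * W.eval s‖ ≤ ε / (C + 1) * B := by
    unfold polyInt
    have hWc := W.continuous
    have hPWc := (P * W).continuous
    have hΦW : Continuous fun s => Φ s * W.eval s := hΦ.mul hWc
    rw [← intervalIntegral.integral_sub (hPWc.intervalIntegrable _ _)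
      (hΦW.intervalIntegrable _ _), hB, ← intervalIntegral.integral_const_mul]
    refine intervalIntegral.norm_integral_le_of_norm_le (by norm_num)
      (.of_forall fun s hs => ?_) ((hWc.norm.const_mul _).intervalIntegrable _ _)
    rw [Polynomial.eval_mul, ← sub_mul, norm_mul, Real.norm_eq_abs]
    gcongr
    exact (hP _ ⟨hs.1.le, hs.2⟩).le
  rw [hPF] at h1
  have h3 : ‖((omega (2 * k + 1) * polyInt (P * W) : ℝ) : ℂ) * Y x -
      ((omega (2 * k + 1) * ∫ s in (-1 : ℝ)..1, Φ s * W.eval s : ℝ) : ℂ) * Y x‖ ≤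
      ε / (C + 1) * (omega (2 * k + 1) * B * ‖Y x‖) := by
    rw [← sub_mul, ← Complex.ofReal_sub, ← mul_sub, norm_mul, Complex.norm_real, norm_mul,
      Real.norm_of_nonneg hω.le]
    calc omega (2 * k + 1) * ‖polyInt (P * W) - ∫ s in (-1 : ℝ)..1, Φ s * W.eval s‖ * ‖Y x‖
        ≤ omega (2 * k + 1) * (ε / (C + 1) * B) * ‖Y x‖ := by gcongr
      _ = _ := by ring
  refine (norm_sub_le_norm_sub_add_norm_sub _ _ _).trans ((add_le_add h1 h3).trans ?_)
  rw [← mul_add, ← hC, zero_add, div_mul_eq_mul_div, div_le_iff₀ (by positivity)]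
  nlinarith

end FunkHecke

/-! ### The Volterra operator with polynomial kernel and its derivative. -/

section Kernel

open Polynomial

/-- The cosine, as a function of `r` and `t`, of the angle at the origin of a triangle with sides
`1`, `r`, `t`, where `t` is opposite to the origin. -/
def cosAngle (r t : ℝ) : ℝ := (1 + r ^ 2 - t ^ 2) / (2 * r)

/-- The integral operator with kernel `p (cosAngle r t)` applied to `b`. -/
def kern (p : ℝ[X]) (b : ℝ → ℂ) (t : ℝ) : ℂ :=
  ∫ r in (1 - t)..1, b r * ((p.eval (cosAngle r t) : ℝ) : ℂ)

theorem uIcc_subset_Ioi {t : ℝ} (ht : t < 1) : uIcc (1 - t) 1 ⊆ Ioi 0 := fun r hr => by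
  rcases mem_uIcc.1 hr with h | h
  · exact (sub_pos.2 ht).trans_le h.1
  · exact one_pos.trans_le h.1

theorem intervalIntegrable_kern (p : ℝ[X]) {b : ℝ → ℂ} (hb : ContinuousOn b (Ioi 0)) {t : ℝ}
    (ht : t < 1) :
    IntervalIntegrable (fun r => b r * ((p.eval (cosAngle r t) : ℝ) : ℂ)) volume (1 - t) 1 := by
  refine ContinuousOn.intervalIntegrable ?_
  refine ContinuousOn.mono ?_ (uIcc_subset_Ioi ht)
  refine hb.mul (Complex.continuous_ofReal.comp_continuousOn (p.continuous.comp_continuousOn ?_))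
  unfold cosAngle
  exact ContinuousOn.div (by fun_prop) (by fun_prop) fun r hr =>
    mul_ne_zero two_ne_zero (ne_of_gt hr)

theorem kern_add (p₁ p₂ : ℝ[X]) {b : ℝ → ℂ} (hb : ContinuousOn b (Ioi 0)) {t : ℝ} (ht : t < 1) :
    kern (p₁ + p₂) b t = kern p₁ b t + kern p₂ b t := by
  unfold kern
  rw [← intervalIntegral.integral_add (intervalIntegrable_kern p₁ hb ht)
    (intervalIntegrable_kern p₂ hb ht)]
  simp [mul_add]

theorem kern_const_mul (p : ℝ[X]) (a : ℂ) (b : ℝ → ℂ) (t : ℝ) :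
    kern p (fun r => a * b r) t = a * kern p b t := by
  unfold kern
  rw [← intervalIntegral.integral_const_mul]
  simp [mul_assoc]

theorem kern_C_mul (p : ℝ[X]) (a : ℝ) (b : ℝ → ℂ) (t : ℝ) :
    kern (C a * p) b t = a * kern p b t := by
  unfold kern
  rw [← intervalIntegral.integral_const_mul]
  simp [mul_left_comm]

theorem kern_congr (p : ℝ[X]) {b b' : ℝ → ℂ} (h : EqOn b b' (Ioi 0)) {t : ℝ} (ht : t < 1) :
    kern p b t = kern p b' t :=
  intervalIntegral.integral_congr fun r hr => by
    simp only [h (uIcc_subset_Ioi ht hr)]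

theorem continuousOn_mul_ofReal {b : ℝ → ℂ} (hb : ContinuousOn b (Ioi 0)) {g : ℝ → ℝ}
    (hg : ContinuousOn g (Ioi 0)) : ContinuousOn (fun r => b r * ((g r : ℝ) : ℂ)) (Ioi 0) :=
  hb.mul (Complex.continuous_ofReal.comp_continuousOn hg)

theorem continuousOn_one_div_two_mul : ContinuousOn (fun r : ℝ => 1 / (2 * r)) (Ioi 0) :=
  ContinuousOn.div (by fun_prop) (by fun_prop) fun r hr => mul_ne_zero two_ne_zero (ne_of_gt hr)

theorem continuousOn_neg_one_div : ContinuousOn (fun r : ℝ => -1 / r) (Ioi 0) :=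
  ContinuousOn.div (by fun_prop) (by fun_prop) fun r hr => ne_of_gt hr

/-- The cosine is affine in `t²` with coefficients depending on `r` alone, and these can be absorbed
into `b`. -/
theorem kern_X_mul (p : ℝ[X]) {b : ℝ → ℂ} (hb : ContinuousOn b (Ioi 0)) {t : ℝ} (ht : t < 1) :
    kern (X * p) b t = kern p (fun r => b r * (((1 + r ^ 2) * (1 / (2 * r)) : ℝ) : ℂ)) t -
      (t : ℂ) ^ 2 * kern p (fun r => b r * ((1 / (2 * r) : ℝ) : ℂ)) t := by
  rw [← kern_const_mul]
  unfold kern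
  rw [← intervalIntegral.integral_sub]
  · refine intervalIntegral.integral_congr fun r _ => ?_
    have h : (cosAngle r t : ℂ) = (1 + r ^ 2) * (1 / (2 * r)) - t ^ 2 * (1 / (2 * r)) := by
      rw [cosAngle]
      push_cast
      ring
    simp only [eval_mul, eval_X, Complex.ofReal_mul, h]
    push_cast
    ring
  · exact intervalIntegrable_kern p (continuousOn_mul_ofReal hb
      (ContinuousOn.mul (by fun_prop) continuousOn_one_div_two_mul)) ht
  · exact intervalIntegrable_kern p (continuousOn_const.mul (continuousOn_mul_ofReal hb
      continuousOn_one_div_two_mul)) ht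

/-- Leibniz rule with `cosAngle (1 - t) t = 1` at the moving endpoint and `∂ cosAngle / ∂t = -t/r`.
Induction on `p` through `kern_X_mul` leaves only the fundamental theorem of calculus, for constant
`p`. -/
theorem hasDerivAt_kern (p : ℝ[X]) {b : ℝ → ℂ} (hb : ContinuousOn b (Ioi 0)) {t : ℝ}
    (ht : t < 1) :
    HasDerivAt (kern p b) (b (1 - t) * ((p.eval 1 : ℝ) : ℂ) +
      t * kern (derivative p) (fun r => b r * ((-1 / r : ℝ) : ℂ)) t) t := by
  have hnhds : Iio (1 : ℝ) ∈ nhds t := Iio_mem_nhds ht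
  induction p using Polynomial.induction_on generalizing b with
  | C a =>
    have h1 : HasDerivAt (fun x => ∫ r in x..1, b r) (-b (1 - t)) (1 - t) := by
      have hpos : Ioi (0 : ℝ) ∈ nhds (1 - t) := Ioi_mem_nhds (sub_pos.2 ht)
      refine intervalIntegral.integral_hasDerivAt_left
        (hb.mono (uIcc_subset_Ioi ht)).intervalIntegrable ?_ (hb.continuousAt hpos)
      exact hb.stronglyMeasurableAtFilter isOpen_Ioi _ (sub_pos.2 ht)
    have h2 := (h1.scomp t ((hasDerivAt_id t).const_sub 1)).mul_const ((a : ℝ) : ℂ)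
    have h3 : kern (C a) b = fun t => (∫ r in (1 - t)..1, b r) * ((a : ℝ) : ℂ) := by
      funext s
      unfold kern
      rw [← intervalIntegral.integral_mul_const]
      simp
    rw [h3]
    exact h2.congr_deriv (by simp [kern])
  | add p₁ p₂ h₁ h₂ =>
    have h := (h₁ hb).add (h₂ hb)
    refine (h.congr_of_eventuallyEq ?_).congr_deriv ?_
    · filter_upwards [hnhds] with s hs using kern_add p₁ p₂ hb hs
    · rw [derivative_add, kern_add _ _ (continuousOn_mul_ofReal hb continuousOn_neg_one_div) ht]
      simp only [eval_add, Complex.ofReal_add]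
      ring
  | monomial m a ih =>
    have hp : C a * X ^ (m + 1) = X * (C a * X ^ m) := by ring
    rw [hp]
    generalize C a * X ^ m = p at ih
    have hb1 : ContinuousOn (fun r => b r * (((1 + r ^ 2) * (1 / (2 * r)) : ℝ) : ℂ)) (Ioi 0) :=
      continuousOn_mul_ofReal hb (ContinuousOn.mul (by fun_prop) continuousOn_one_div_two_mul)
    have hb2 := continuousOn_mul_ofReal hb continuousOn_one_div_two_mul
    have hb3 := continuousOn_mul_ofReal hb continuousOn_neg_one_div
    have hsq : HasDerivAt (fun t : ℝ => (t : ℂ) ^ 2) (2 * t) t := by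
      have h := (hasDerivAt_pow 2 t).ofReal_comp
      simp only [Complex.ofReal_pow] at h
      exact h.congr_deriv (by simp)
    have h := (ih hb1).sub (hsq.mul (ih hb2))
    refine (h.congr_of_eventuallyEq ?_).congr_deriv ?_
    · filter_upwards [hnhds] with s hs using kern_X_mul p hb hs
    · rw [derivative_mul, derivative_X, one_mul, kern_add _ _ hb3 ht, kern_X_mul _ hb3 ht]
      have e1 : kern p (fun r => b r * ((-1 / r : ℝ) : ℂ)) t =
          -2 * kern p (fun r => b r * ((1 / (2 * r) : ℝ) : ℂ)) t := by
        rw [← kern_const_mul]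
        refine kern_congr p (fun r hr => ?_) ht
        have : (r : ℂ) ≠ 0 := Complex.ofReal_ne_zero.2 (ne_of_gt hr)
        push_cast
        field_simp
      have e2 : ∀ g : ℝ → ℝ, (fun r => b r * ((-1 / r : ℝ) : ℂ) * ((g r : ℝ) : ℂ)) =
          fun r => b r * ((g r : ℝ) : ℂ) * ((-1 / r : ℝ) : ℂ) := fun g => by
        funext r; ring
      rw [e1, e2 fun r => (1 + r ^ 2) * (1 / (2 * r)), e2 fun r => 1 / (2 * r)]
      have h1t : (1 - t : ℂ) ≠ 0 := by
        exact_mod_cast Complex.ofReal_ne_zero.2 (sub_pos.2 ht).ne'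
      simp only [eval_mul, eval_X, one_mul]
      push_cast
      field_simp
      ring

end Kernel

/-! ### The data as a Volterra transform of the coefficients of the function. -/

section MeanFormula

theorem coeffF_eq_zero {n : ℕ} {f : Eucl n → ℂ} (hfB : tsupport f ⊆ ball (0 : Eucl n) 1)
    (Y : USphere n → ℂ) {r : ℝ} (hr : 1 ≤ r) : coeffF n f Y r = 0 := by
  unfold coeffF
  refine integral_eq_zero_of_ae (.of_forall fun θ => ?_)
  have : r • (θ : Eucl n) ∉ tsupport f := fun h => by
    have h2 := hfB h
    rw [mem_ball_zero_iff, norm_smul, norm_eq_of_mem_sphere, mul_one,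
      Real.norm_of_nonneg (by linarith)] at h2
    linarith
  simp [image_eq_zero_of_notMem_tsupport this]

theorem funkHecke_conj {k q : ℕ} {Y : USphere (2 * k + 3) → ℂ}
    (hY : IsSphericalHarmonic (2 * k + 3) q Y) (x : USphere (2 * k + 3)) {Φ : ℝ → ℝ}
    (hΦ : Continuous Φ) :
    ∫ p : USphere (2 * k + 3), ((Φ (inner ℝ (x : Eucl (2 * k + 3)) (p : Eucl _)) : ℝ) : ℂ) *
        starRingEnd ℂ (Y p) ∂(surf (2 * k + 3)) =
      ((omega (2 * k + 1) * ∫ s in (-1 : ℝ)..1, Φ s * (zonalPoly k q).eval s : ℝ) : ℂ) *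
        starRingEnd ℂ (Y x) := by
  have h := congrArg (starRingEnd ℂ) (funkHecke hY x hΦ)
  rw [← integral_conj] at h
  simpa only [map_mul, Complex.conj_ofReal] using h

theorem continuous_sphericalMean {n : ℕ} {f : Eucl n → ℂ} (hf : Continuous f) :
    Continuous fun z : Eucl n × ℝ => sphericalMean n f z.1 z.2 := by
  unfold sphericalMean
  refine continuous_const.mul ?_
  have := continuous_parametric_integral_of_continuous (μ := surf n)
    (f := fun (z : Eucl n × ℝ) (θ : USphere n) => f (z.1 + z.2 • (θ : Eucl n)))
    (by unfold Function.uncurry; fun_prop) isCompact_univ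
  simpa using this

variable {k q : ℕ} {f : Eucl (2 * k + 3) → ℂ} {Y : USphere (2 * k + 3) → ℂ} {Ψ : ℝ → ℝ}

theorem integral_mul_radial_about (hf : Continuous f) (hfc : HasCompactSupport f)
    (hΨ : Continuous Ψ) (hΨ0 : ∀ t ∉ Ioo (0 : ℝ) 1, Ψ t = 0) (p : Eucl (2 * k + 3)) :
    ∫ x : Eucl (2 * k + 3), f x * ((Ψ ‖x - p‖ : ℝ) : ℂ) =
      ∫ r : ℝ, ((r ^ (2 * k + 2) * Ψ r * omega (2 * k + 2) : ℝ) : ℂ) *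
        sphericalMean (2 * k + 3) f p r := by
  rw [← integral_add_left_eq_self (μ := volume) _ p]
  simp only [add_sub_cancel_left]
  have hint : Integrable fun y : Eucl (2 * k + 3) => f (p + y) * ((Ψ ‖y‖ : ℝ) : ℂ) := by
    refine Continuous.integrable_of_hasCompactSupport (by fun_prop) ?_
    exact HasCompactSupport.mul_right (hfc.comp_homeomorph (Homeomorph.addLeft p))
  rw [integral_polar (by omega) hint, eq_comm,
    ← setIntegral_eq_integral_of_forall_compl_eq_zero (s := Ioi (0 : ℝ))
    (fun r hr => by rw [hΨ0 r fun h => hr h.1]; simp), eq_comm]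
  refine setIntegral_congr_fun measurableSet_Ioi fun r hr => ?_
  have hr0 : (0 : ℝ) < r := hr
  have h1 : ∀ θ : USphere (2 * k + 3), ‖r • (θ : Eucl (2 * k + 3))‖ = r := fun θ => by
    rw [norm_smul, norm_eq_of_mem_sphere θ, mul_one, Real.norm_of_nonneg hr0.le]
  simp only [h1, sphericalMean]
  rw [integral_mul_const, Complex.real_smul]
  have hω : (omega (2 * k + 2) : ℂ) ≠ 0 := Complex.ofReal_ne_zero.2 (omega_pos _).ne'
  have e : 2 * k + 3 - 1 = 2 * k + 2 := by omega
  rw [e]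
  push_cast
  field_simp

/-- First evaluation of the double integral: polar coordinates about `p`, then the integral over
`p`. -/
theorem integral_mul_dataH (hf : Continuous f) (hfc : HasCompactSupport f) (hY : Continuous Y)
    (hΨ : Continuous Ψ) (hΨ0 : ∀ t ∉ Ioo (0 : ℝ) 1, Ψ t = 0) :
    ∫ p : USphere (2 * k + 3), (∫ x : Eucl (2 * k + 3), f x * ((Ψ ‖x - p‖ : ℝ) : ℂ)) *
        starRingEnd ℂ (Y p) ∂(surf (2 * k + 3)) =
      (omega (2 * k + 1) : ℂ) *
        ∫ r : ℝ, ((r * Ψ r : ℝ) : ℂ) * dataH (2 * k + 3) k f Y r := by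
  simp only [integral_mul_radial_about hf hfc hΨ hΨ0]
  simp only [← integral_mul_const]
  have hYc : Continuous fun p => starRingEnd ℂ (Y p) := Complex.continuous_conj.comp hY
  have hm := continuous_sphericalMean hf
  rw [integral_integral_swap_of_hasCompactSupport]
  · rw [← integral_const_mul]
    refine integral_congr_ae (.of_forall fun r => ?_)
    simp only [mul_assoc, integral_const_mul]
    rw [← coeffG, dataH]
    have hω : (omega (2 * k + 1) : ℂ) ≠ 0 := Complex.ofReal_ne_zero.2 (omega_pos _).ne'
    push_cast
    field_simp
    ring
  · have h2 : Continuous fun z : USphere (2 * k + 3) × ℝ =>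
        sphericalMean (2 * k + 3) f (z.1 : Eucl (2 * k + 3)) z.2 :=
      hm.comp (by fun_prop : Continuous fun z : USphere (2 * k + 3) × ℝ =>
        ((z.1 : Eucl (2 * k + 3)), z.2))
    unfold Function.uncurry
    fun_prop
  · refine HasCompactSupport.intro (isCompact_univ.prod (isCompact_Icc (a := (0 : ℝ)) (b := 1)))
      fun z hz => ?_
    have : Ψ z.2 = 0 := hΨ0 _ fun h => hz ⟨mem_univ _, h.1.le, h.2.le⟩
    simp [Function.uncurry, this]

theorem norm_smul_sub_sphere {n : ℕ} (σ p : USphere n) (r : ℝ) :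
    ‖r • (σ : Eucl n) - p‖ = √(1 + r ^ 2 - 2 * r * inner ℝ (σ : Eucl n) (p : Eucl n)) := by
  have h : ‖r • (σ : Eucl n) - p‖ ^ 2 = 1 + r ^ 2 - 2 * r * inner ℝ (σ : Eucl n) (p : Eucl n) := by
    rw [norm_sub_sq_real, norm_smul, norm_eq_of_mem_sphere, norm_eq_of_mem_sphere,
      real_inner_smul_left, mul_one, Real.norm_eq_abs, sq_abs]
    ring
  rw [← h, Real.sqrt_sq (norm_nonneg _)]

/-- Second evaluation: for `x = rσ` the distance to `p` depends only on `r` and `⟨σ,p⟩`, so the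
integral over `p` is a Funk–Hecke integral. -/
theorem integral_mul_zonal (hf : Continuous f) (hfc : HasCompactSupport f)
    (hY : IsSphericalHarmonic (2 * k + 3) q Y) (hΨ : Continuous Ψ) :
    ∫ p : USphere (2 * k + 3), (∫ x : Eucl (2 * k + 3), f x * ((Ψ ‖x - p‖ : ℝ) : ℂ)) *
        starRingEnd ℂ (Y p) ∂(surf (2 * k + 3)) =
      (omega (2 * k + 1) : ℂ) * ∫ r in Ioi (0 : ℝ), ((r ^ (2 * k + 2) *
        ∫ s in (-1 : ℝ)..1, Ψ √(1 + r ^ 2 - 2 * r * s) * (zonalPoly k q).eval s : ℝ) : ℂ) *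
          coeffF (2 * k + 3) f Y r := by
  have hYc := hY.continuous
  simp only [← integral_mul_const]
  rw [integral_integral_swap_of_hasCompactSupport]
  · simp only [mul_assoc, integral_const_mul]
    rw [integral_polar (by omega), ← integral_const_mul]
    · refine setIntegral_congr_fun measurableSet_Ioi fun r hr => ?_
      have h1 : ∀ σ : USphere (2 * k + 3), ∫ p : USphere (2 * k + 3),
          ((Ψ ‖r • (σ : Eucl (2 * k + 3)) - p‖ : ℝ) : ℂ) * starRingEnd ℂ (Y p)
          ∂(surf (2 * k + 3)) = _ := fun σ => by
        simp only [norm_smul_sub_sphere]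
        exact funkHecke_conj hY σ (Φ := fun s => Ψ √(1 + r ^ 2 - 2 * r * s)) (by fun_prop)
      simp only [h1, Complex.real_smul, coeffF, mul_left_comm (f _), integral_const_mul]
      have e : 2 * k + 3 - 1 = 2 * k + 2 := by omega
      rw [e]
      simp only [Complex.ofReal_mul, Complex.ofReal_pow]
      ring_nf
    · refine Continuous.integrable_of_hasCompactSupport (hf.mul ?_) hfc.mul_right
      have := continuous_parametric_integral_of_continuous (μ := surf (2 * k + 3))
        (f := fun (x : Eucl (2 * k + 3)) (p : USphere (2 * k + 3)) =>
          ((Ψ ‖x - p‖ : ℝ) : ℂ) * starRingEnd ℂ (Y p))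
        (by unfold Function.uncurry; fun_prop) isCompact_univ
      simpa using this
  · unfold Function.uncurry
    fun_prop
  · refine HasCompactSupport.intro (isCompact_univ.prod hfc.isCompact) fun z hz => ?_
    have : f z.2 = 0 := image_eq_zero_of_notMem_tsupport fun h => hz ⟨mem_univ _, h⟩
    simp [Function.uncurry, this]

/-- Law of cosines: `s = cosAngle r t` means `t = √(1 + r² - 2rs)`, and `t` runs over `[1 - r, 1 +
r]`. The part with `t ≥ 1` contributes nothing because `Ψ` vanishes there. -/
theorem zonal_substitution (P : Polynomial ℝ) (hΨ : Continuous Ψ)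
    (hΨ0 : ∀ t ∉ Ioo (0 : ℝ) 1, Ψ t = 0) {r : ℝ} (hr : r ∈ Ioo (0 : ℝ) 1) :
    r * ∫ s in (-1 : ℝ)..1, Ψ √(1 + r ^ 2 - 2 * r * s) * P.eval s =
      ∫ t in (1 - r)..1, t * Ψ t * P.eval (cosAngle r t) := by
  have hr0 : r ≠ 0 := hr.1.ne'
  have hPc := P.continuous
  have hcos : Continuous (cosAngle r) := by unfold cosAngle; fun_prop
  have hd : ∀ t, HasDerivAt (cosAngle r) (-(t / r)) t := fun t => by
    have h := ((hasDerivAt_pow 2 t).const_sub (1 + r ^ 2)).div_const (2 * r)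
    refine h.congr_deriv ?_
    field_simp
    simp
  have h := intervalIntegral.integral_comp_mul_deriv (a := 1 - r) (b := 1 + r)
    (f := cosAngle r) (f' := fun t => -(t / r))
    (g := fun s => Ψ √(1 + r ^ 2 - 2 * r * s) * P.eval s) (fun t _ => hd t)
    (by fun_prop) (by fun_prop)
  have e1 : cosAngle r (1 - r) = 1 := by unfold cosAngle; field_simp; ring
  have e2 : cosAngle r (1 + r) = -1 := by unfold cosAngle; field_simp; ring
  rw [e1, e2, intervalIntegral.integral_symm (-1) 1] at h
  have h2 : ∫ t in (1 - r)..(1 + r), ((fun s => Ψ √(1 + r ^ 2 - 2 * r * s) * P.eval s) ∘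
      cosAngle r) t * -(t / r) = ∫ t in (1 - r)..(1 + r), -(1 / r) *
        (t * Ψ t * P.eval (cosAngle r t)) := by
    refine intervalIntegral.integral_congr fun t ht => ?_
    have ht0 : 0 ≤ t := by
      rw [uIcc_of_le (by linarith [hr.1])] at ht
      linarith [ht.1, hr.2]
    have : √(1 + r ^ 2 - 2 * r * cosAngle r t) = t := by
      rw [show 1 + r ^ 2 - 2 * r * cosAngle r t = t ^ 2 by unfold cosAngle; field_simp; ring,
        Real.sqrt_sq ht0]
    simp only [Function.comp_apply, this]
    ring
  have hc : Continuous fun t => t * Ψ t * P.eval (cosAngle r t) := by fun_prop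
  have h3 : ∫ t in (1 : ℝ)..(1 + r), t * Ψ t * P.eval (cosAngle r t) = 0 := by
    refine (intervalIntegral.integral_congr (g := fun _ => 0) fun t ht => ?_).trans (by simp)
    rw [uIcc_of_le (by linarith [hr.1])] at ht
    simp [hΨ0 t fun h => absurd h.2 (not_lt.2 ht.1)]
  rw [h2, intervalIntegral.integral_const_mul, ← intervalIntegral.integral_add_adjacent_intervals
    (hc.intervalIntegrable _ 1) (hc.intervalIntegrable _ _), h3, add_zero] at h
  have h' := neg_injective ((neg_mul _ _).symm.trans h)
  rw [← h', ← mul_assoc, mul_one_div_cancel hr0, one_mul]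

theorem cosAngle_mem_Icc {r t : ℝ} (hr : 0 < r) (h1 : 1 - r ≤ t) (h2 : r ≤ 1) (ht : t ≤ 1) :
    cosAngle r t ∈ Icc (-1 : ℝ) 1 := by
  unfold cosAngle
  constructor
  · rw [le_div_iff₀ (by positivity)]
    nlinarith
  · rw [div_le_iff₀ (by positivity)]
    nlinarith

/-- Fubini on the triangle `1 - r < t` in the unit square, a condition symmetric in `r` and `t`.
There `cosAngle` stays in `[-1,1]`, despite the division by `r`, which gives integrability. -/
theorem integral_kern_swap (P : Polynomial ℝ) {b : ℝ → ℂ} (hb : Continuous b) {ψ : ℝ → ℝ}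
    (hψ : Continuous ψ) :
    ∫ r in Ioo (0 : ℝ) 1, b r * ((∫ t in (1 - r)..1, ψ t * P.eval (cosAngle r t) : ℝ) : ℂ) =
      ∫ t in Ioo (0 : ℝ) 1, (ψ t : ℂ) * kern P b t := by
  set g : ℝ → ℝ → ℂ := fun r t =>
    {z : ℝ × ℝ | 1 - z.1 < z.2}.indicator
      (fun z => b z.1 * ((ψ z.2 * P.eval (cosAngle z.1 z.2) : ℝ) : ℂ)) (r, t) with hg
  have hset : MeasurableSet {z : ℝ × ℝ | 1 - z.1 < z.2} :=
    measurableSet_lt (by fun_prop) (by fun_prop)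
  have hmeas : Measurable (Function.uncurry g) := by
    refine Measurable.indicator ?_ hset
    have h1 : Measurable fun z : ℝ × ℝ => cosAngle z.1 z.2 := by unfold cosAngle; fun_prop
    have h2 := P.continuous.measurable.comp h1
    have h3 := hb.measurable
    have h4 := hψ.measurable
    simp only [Function.comp_def] at h2
    fun_prop
  obtain ⟨B, hB⟩ := (isCompact_Icc (a := (0 : ℝ)) (b := 1)).exists_bound_of_continuousOn
    hb.continuousOn
  obtain ⟨C, hC⟩ := (isCompact_Icc (a := (0 : ℝ)) (b := 1)).exists_bound_of_continuousOn
    hψ.continuousOn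
  obtain ⟨D, hD⟩ := (isCompact_Icc (a := (-1 : ℝ)) (b := 1)).exists_bound_of_continuousOn
    P.continuous.continuousOn
  have hB0 : 0 ≤ B := (norm_nonneg _).trans (hB 0 (by simp))
  have hC0 : 0 ≤ C := (norm_nonneg _).trans (hC 0 (by simp))
  have hD0 : 0 ≤ D := (norm_nonneg _).trans (hD 0 (by simp))
  have hint : Integrable (Function.uncurry g)
      ((volume.restrict (Ioo (0 : ℝ) 1)).prod (volume.restrict (Ioo (0 : ℝ) 1))) := by
    refine Integrable.of_bound hmeas.aestronglyMeasurable (B * (C * D)) ?_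
    rw [Measure.prod_restrict]
    filter_upwards [ae_restrict_mem (measurableSet_Ioo.prod measurableSet_Ioo)] with z hz
    simp only [Function.uncurry, hg]
    by_cases h : 1 - z.1 < z.2
    · rw [indicator_of_mem (show (z.1, z.2) ∈ _ from h), norm_mul, Complex.norm_real, norm_mul]
      gcongr
      · exact hB _ ⟨hz.1.1.le, hz.1.2.le⟩
      · exact hC _ ⟨hz.2.1.le, hz.2.2.le⟩
      · exact hD _ (cosAngle_mem_Icc hz.1.1 h.le hz.1.2.le hz.2.2.le)
    · rw [indicator_of_notMem (show (z.1, z.2) ∉ _ from h), norm_zero]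
      positivity
  have hswap := integral_integral_swap hint
  have hleft : ∀ r ∈ Ioo (0 : ℝ) 1, ∫ t in Ioo (0 : ℝ) 1, g r t =
      b r * ((∫ t in (1 - r)..1, ψ t * P.eval (cosAngle r t) : ℝ) : ℂ) := fun r hr => by
    have : ∀ t, g r t = (Ioi (1 - r)).indicator
      (fun t => b r * ((ψ t * P.eval (cosAngle r t) : ℝ) : ℂ)) t := fun t => rfl
    simp only [this]
    rw [setIntegral_indicator measurableSet_Ioi, Ioo_inter_Ioi, sup_eq_right.2 (by linarith [hr.2]),
      integral_const_mul, ← integral_Ioc_eq_integral_Ioo,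
      ← intervalIntegral.integral_of_le (by linarith [hr.1]), intervalIntegral.integral_ofReal]
  have hright : ∀ t ∈ Ioo (0 : ℝ) 1, ∫ r in Ioo (0 : ℝ) 1, g r t = (ψ t : ℂ) * kern P b t :=
    fun t ht => by
    have : ∀ r, g r t = (Ioi (1 - t)).indicator
        (fun r => (ψ t : ℂ) * (b r * ((P.eval (cosAngle r t) : ℝ) : ℂ))) r := fun r => by
      simp only [hg, indicator, mem_ofPred_eq, mem_Ioi, sub_lt_comm (b := r)]
      split_ifs
      · push_cast; ring
      · rfl
    simp only [this]
    rw [setIntegral_indicator measurableSet_Ioi, Ioo_inter_Ioi, sup_eq_right.2 (by linarith [ht.2]),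
      integral_const_mul, ← integral_Ioc_eq_integral_Ioo,
      ← intervalIntegral.integral_of_le (by linarith [ht.1]), kern]
  rw [setIntegral_congr_fun measurableSet_Ioo hleft,
    setIntegral_congr_fun measurableSet_Ioo hright] at hswap
  exact hswap

theorem integral_test_dataH (hf : ContDiff ℝ ∞ f) (hfc : HasCompactSupport f)
    (hfB : tsupport f ⊆ ball (0 : Eucl (2 * k + 3)) 1)
    (hY : IsSphericalHarmonic (2 * k + 3) q Y) (hΨ : Continuous Ψ)
    (hΨ0 : ∀ t ∉ Ioo (0 : ℝ) 1, Ψ t = 0) :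
    ∫ t in Ioo (0 : ℝ) 1, ((t * Ψ t : ℝ) : ℂ) * dataH (2 * k + 3) k f Y t =
      ∫ t in Ioo (0 : ℝ) 1, ((t * Ψ t : ℝ) : ℂ) * kern (zonalPoly k q)
        (fun r => (r : ℂ) ^ (2 * k + 1) * coeffF (2 * k + 3) f Y r) t := by
  have hFc := (contDiff_coeffF hf hY.continuous).continuous
  have h1 := integral_mul_dataH hf.continuous hfc hY.continuous hΨ hΨ0
  rw [integral_mul_zonal hf.continuous hfc hY hΨ] at h1
  have hω : (omega (2 * k + 1) : ℂ) ≠ 0 := Complex.ofReal_ne_zero.2 (omega_pos _).ne'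
  have h2 := mul_left_cancel₀ hω h1
  rw [setIntegral_eq_integral_of_forall_compl_eq_zero
    (fun t ht => by rw [hΨ0 t ht]; simp), ← h2,
    ← integral_kern_swap (zonalPoly k q) (by fun_prop) (by fun_prop)]
  have hsub : Ioo (0 : ℝ) 1 ⊆ Ioi 0 := fun r hr => hr.1
  rw [setIntegral_eq_of_subset_of_forall_sdiff_eq_zero measurableSet_Ioi hsub]
  · refine setIntegral_congr_fun measurableSet_Ioo fun r hr => ?_
    rw [← zonal_substitution _ hΨ hΨ0 hr]
    push_cast
    ring
  · intro r hr
    rw [coeffF_eq_zero hfB Y (not_lt.1 fun h => hr.2 ⟨hr.1, h⟩), mul_zero]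

/-- The spherical-harmonic coefficients of the spherical mean as an integral transform of those of
the function. -/
theorem dataH_eq_kern (hf : ContDiff ℝ ∞ f) (hfc : HasCompactSupport f)
    (hfB : tsupport f ⊆ ball (0 : Eucl (2 * k + 3)) 1)
    (hY : IsSphericalHarmonic (2 * k + 3) q Y) :
    EqOn (dataH (2 * k + 3) k f Y) (kern (zonalPoly k q)
        (fun r => (r : ℂ) ^ (2 * k + 1) * coeffF (2 * k + 3) f Y r)) (Ioo 0 1) := by
  have hFc := (contDiff_coeffF hf hY.continuous).continuous
  have hbc : Continuous fun r : ℝ => (r : ℂ) ^ (2 * k + 1) * coeffF (2 * k + 3) f Y r := by fun_prop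
  set H := kern (zonalPoly k q) (fun r => (r : ℂ) ^ (2 * k + 1) * coeffF (2 * k + 3) f Y r)
  have hHc : ContinuousOn H (Ioo 0 1) := fun t ht =>
    (hasDerivAt_kern _ hbc.continuousOn ht.2).continuousAt.continuousWithinAt
  have hDc : ContinuousOn (dataH (2 * k + 3) k f Y) (Ioo 0 1) :=
    (contDiff_dataH hf hY.continuous).continuous.continuousOn
  have hae : ∀ᵐ t, t ∈ Ioo (0 : ℝ) 1 → (dataH (2 * k + 3) k f Y - H) t = 0 := by
    refine isOpen_Ioo.ae_eq_zero_of_integral_contDiff_smul_eq_zero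
      ((hDc.sub hHc).locallyIntegrableOn measurableSet_Ioo) fun ψ hψ hψc hψs => ?_
    have hψ0 : ∀ t ∉ Ioo (0 : ℝ) 1, ψ t = 0 := fun t ht =>
      image_eq_zero_of_notMem_tsupport fun h => ht (hψs h)
    -- Dividing by `t` cancels the weight `t` of `integral_test_dataH`; it is harmless because the
    -- support of `ψ` stays away from `0`.
    set Ψ : ℝ → ℝ := fun t => ψ t / t with hΨ
    have hΨc : Continuous Ψ := by
      refine continuous_of_tsupport fun t ht => ?_
      have h1 : tsupport Ψ ⊆ tsupport ψ := closure_mono fun t ht h => ht (by simp [hΨ, h])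
      exact hψ.continuous.continuousAt.div continuousAt_id (hψs (h1 ht)).1.ne'
    have h := integral_test_dataH hf hfc hfB hY hΨc fun t ht => by simp [hΨ, hψ0 t ht]
    have e : ∀ F : ℝ → ℂ, ∫ t in Ioo (0 : ℝ) 1, ((t * Ψ t : ℝ) : ℂ) * F t =
        ∫ t in Ioo (0 : ℝ) 1, ψ t • F t := fun F =>
      setIntegral_congr_fun measurableSet_Ioo fun t ht => by
        simp only [hΨ, mul_div_cancel₀ _ ht.1.ne', Complex.real_smul]
    rw [e, e] at h
    have hi : ∀ F : ℝ → ℂ, ContinuousOn F (Ioo 0 1) →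
        IntegrableOn (fun t => ψ t • F t) (Ioo 0 1) := fun F hF => by
      have : Continuous fun t => ψ t • F t := by
        refine continuous_of_tsupport fun t ht => ?_
        have ht' : t ∈ Ioo (0 : ℝ) 1 := hψs (tsupport_smul_subset_left ψ F ht)
        exact hψ.continuous.continuousAt.smul (hF.continuousAt (isOpen_Ioo.mem_nhds ht'))
      exact (this.integrable_of_hasCompactSupport hψc.smul_right).integrableOn
    rw [← setIntegral_eq_integral_of_forall_compl_eq_zero (s := Ioo (0 : ℝ) 1)
      fun t ht => by rw [hψ0 t ht, zero_smul]]
    simp only [Pi.sub_apply, smul_sub]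
    rw [integral_sub (hi _ hDc) (hi _ hHc), h, sub_self]
  refine Measure.eqOn_open_of_ae_eq (μ := volume) ?_ isOpen_Ioo hDc hHc
  rw [Filter.EventuallyEq, ae_restrict_iff' measurableSet_Ioo]
  filter_upwards [hae] with t ht h using sub_eq_zero.1 (ht h)

end MeanFormula

/-! ### Iterates of `D`, Bessel coefficients, derivatives of `(1 - X²)^N` at `1`. -/

section Derivatives

theorem hasDerivAt_iteratedDeriv {φ : ℝ → ℂ} {U : Set ℝ} (hU : IsOpen U) {N : WithTop ℕ∞}
    (hφ : ContDiffOn ℝ N φ U) {i : ℕ} (hi : i < N) {t : ℝ} (ht : t ∈ U) :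
    HasDerivAt (iteratedDeriv i φ) (iteratedDeriv (i + 1) φ t) t := by
  have h := (hφ.differentiableOn_iteratedDerivWithin hi hU.uniqueDiffOn).differentiableAt
    (hU.mem_nhds ht)
  have h2 := h.congr_of_eventuallyEq
    ((iteratedDerivWithin_of_isOpen (n := i) (f := φ) hU).symm.eventuallyEq_of_mem
      (hU.mem_nhds ht))
  rw [iteratedDeriv_succ]
  exact h2.hasDerivAt

theorem opD_congr {g h : ℝ → ℂ} {U : Set ℝ} (hU : IsOpen U) (hgh : EqOn g h U) :
    EqOn (opD g) (opD h) U := fun t ht => by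
  unfold opD
  rw [(hgh.eventuallyEq_of_mem (hU.mem_nhds ht)).deriv_eq]

theorem iterate_opD_congr {g h : ℝ → ℂ} {U : Set ℝ} (hU : IsOpen U) (hgh : EqOn g h U) (i : ℕ) :
    EqOn (opD^[i] g) (opD^[i] h) U := by
  induction i with
  | zero => exact hgh
  | succ i ih =>
    rw [Function.iterate_succ_apply', Function.iterate_succ_apply']
    exact opD_congr hU ih

theorem opD_const_mul (a : ℂ) (g : ℝ → ℂ) : opD (fun t => a * g t) = fun t => a * opD g t := by
  funext t
  unfold opD
  rw [deriv_const_mul_field]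
  ring

theorem iterate_opD_const_mul (a : ℂ) (g : ℝ → ℂ) (i : ℕ) :
    opD^[i] (fun t => a * g t) = fun t => a * opD^[i] g t := by
  induction i with
  | zero => rfl
  | succ i ih => rw [Function.iterate_succ_apply', ih, opD_const_mul, Function.iterate_succ_apply']

theorem contDiffOn_opD {g : ℝ → ℂ} (hg : ContDiffOn ℝ ∞ g (Ioo 0 1)) :
    ContDiffOn ℝ ∞ (opD g) (Ioo 0 1) := by
  unfold opD
  refine ContDiffOn.mul ?_ (hg.deriv_of_isOpen isOpen_Ioo (by simp))
  refine Complex.ofRealCLM.contDiff.comp_contDiffOn ?_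
  exact contDiffOn_const.div contDiffOn_id fun t ht => ht.1.ne'

theorem contDiffOn_iterate_opD {g : ℝ → ℂ} (hg : ContDiffOn ℝ ∞ g (Ioo 0 1)) (i : ℕ) :
    ContDiffOn ℝ ∞ (opD^[i] g) (Ioo 0 1) := by
  induction i with
  | zero => exact hg
  | succ i ih =>
    rw [Function.iterate_succ_apply']
    exact contDiffOn_opD ih

/-- The (signed) Bessel polynomial coefficients. -/
def besselCoeff : ℕ → ℕ → ℂ
  | 0, 0 => 1
  | 0, _ + 1 => 0
  | l + 1, 0 => besselCoeff l 0
  | l + 1, a + 1 => besselCoeff l (a + 1) - (l + a + 1) * besselCoeff l a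

theorem besselCoeff_eq_zero {l a : ℕ} (h : l < a) : besselCoeff l a = 0 := by
  induction l generalizing a with
  | zero => obtain ⟨a, rfl⟩ := Nat.exists_eq_succ_of_ne_zero h.ne'; rfl
  | succ l ih =>
    obtain ⟨a, rfl⟩ := Nat.exists_eq_succ_of_ne_zero (by omega : a ≠ 0)
    rw [Nat.succ_eq_add_one, besselCoeff, ih (by omega), ih (by omega)]
    ring

/-- Closed form `(-1)^a (l + a)! / (2^a a! (l - a)!)` with `l = a + d`, cleared of denominators and
of subtraction. -/
theorem besselCoeff_add (a d : ℕ) : besselCoeff (a + d) a * (2 ^ a * a.factorial * d.factorial) =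
    (-1) ^ a * (a + d + a).factorial := by
  induction a generalizing d with
  | zero =>
    have : besselCoeff (0 + d) 0 = 1 := by
      rw [zero_add]
      induction d with
      | zero => rfl
      | succ d ih => rw [besselCoeff, ih]
    rw [this]
    simp
  | succ a iha =>
    induction d with
    | zero =>
      have h := iha 0
      rw [add_zero] at h
      rw [add_zero, besselCoeff, besselCoeff_eq_zero (Nat.lt_succ_self a)]
      have e : a + 1 + (a + 1) = (a + a) + 1 + 1 := by ring
      rw [e, Nat.factorial_succ (a + a + 1), Nat.factorial_succ (a + a), Nat.factorial_succ a]
      push_cast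
      linear_combination (-2 * (a + 1) * (2 * a + 1)) * h
    | succ d ihd =>
      have h := iha (d + 1)
      have e1 : a + 1 + (d + 1) = (a + 1 + d) + 1 := by ring
      have e2 : a + (d + 1) = a + 1 + d := by ring
      have e3 : a + 1 + d + (a + 1) = (a + 1 + d + a) + 1 := by ring
      have e4 : a + 1 + d + 1 + (a + 1) = (a + 1 + d + a) + 1 + 1 := by ring
      rw [e2] at h
      rw [e3, Nat.factorial_succ (a + 1 + d + a)] at ihd
      rw [e1, besselCoeff, e4, Nat.factorial_succ (a + 1 + d + a + 1),
        Nat.factorial_succ (a + 1 + d + a)]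
      rw [Nat.factorial_succ d] at h ⊢
      rw [Nat.factorial_succ a] at ihd ⊢
      push_cast at h ihd ⊢
      linear_combination (d + 1) * ihd - (2 * a + d + 2) * 2 * (a + 1) * h

/-- Applying `D` to a summand either differentiates `φ` once more or lowers the power of `t`;
collecting equal terms is the recursion defining `besselCoeff`. -/
theorem iterate_opD_div {φ : ℝ → ℂ} (hφ : ContDiffOn ℝ ∞ φ (Ioo 0 1)) (l : ℕ) :
    EqOn (opD^[l] fun t => φ t / (t : ℂ)) (fun t => ∑ a ∈ Finset.range (l + 1),
      besselCoeff l a * (iteratedDeriv (l - a) φ t / (t : ℂ) ^ (l + a + 1))) (Ioo 0 1) := by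
  induction l with
  | zero => intro t _; simp [besselCoeff]
  | succ l ih =>
    rw [Function.iterate_succ_apply']
    refine (opD_congr isOpen_Ioo ih).trans fun t ht => ?_
    have ht0 : (t : ℂ) ≠ 0 := Complex.ofReal_ne_zero.2 ht.1.ne'
    have hd : ∀ a ∈ Finset.range (l + 1), HasDerivAt (fun t : ℝ => besselCoeff l a *
        (iteratedDeriv (l - a) φ t / (t : ℂ) ^ (l + a + 1)))
        (t * (besselCoeff l a * (iteratedDeriv (l + 1 - a) φ t / (t : ℂ) ^ (l + 1 + a + 1))) -
          t * ((l + a + 1) * besselCoeff l a *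
            (iteratedDeriv (l - a) φ t / (t : ℂ) ^ (l + 1 + a + 2)))) t := fun a ha => by
      have h1 := hasDerivAt_iteratedDeriv isOpen_Ioo hφ (i := l - a)
        (WithTop.coe_lt_coe.2 (ENat.natCast_lt_top (l - a))) ht
      rw [show l - a + 1 = l + 1 - a by have := Finset.mem_range.1 ha; omega] at h1
      have h2 := (hasDerivAt_pow (l + a + 1) t).ofReal_comp
      simp only [Complex.ofReal_pow] at h2
      refine ((h1.div h2 (pow_ne_zero _ ht0)).const_mul _).congr_deriv ?_
      rw [Nat.add_sub_cancel]
      push_cast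
      field_simp
      ring
    have hs := HasDerivAt.fun_sum hd
    unfold opD
    rw [hs.deriv, Finset.sum_sub_distrib, ← Finset.mul_sum, ← Finset.mul_sum, ← mul_sub,
      ← mul_assoc, Complex.ofReal_div, Complex.ofReal_one, one_div_mul_cancel ht0, one_mul,
      Finset.sum_range_succ' _ (l + 1)]
    simp only [besselCoeff, sub_mul, Finset.sum_sub_distrib]
    have e1 : ∑ a ∈ Finset.range (l + 1), besselCoeff l a *
        (iteratedDeriv (l + 1 - a) φ t / (t : ℂ) ^ (l + 1 + a + 1)) =
        ∑ a ∈ Finset.range (l + 1), besselCoeff l (a + 1) *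
          (iteratedDeriv (l + 1 - (a + 1)) φ t / (t : ℂ) ^ (l + 1 + (a + 1) + 1)) +
          besselCoeff l 0 * (iteratedDeriv (l + 1 - 0) φ t / (t : ℂ) ^ (l + 1 + 0 + 1)) := by
      rw [← Finset.sum_range_succ' (fun a => besselCoeff l a *
        (iteratedDeriv (l + 1 - a) φ t / (t : ℂ) ^ (l + 1 + a + 1))), Finset.sum_range_succ _ (l + 1),
        besselCoeff_eq_zero (Nat.lt_succ_self l)]
      ring
    rw [e1]
    simp only [Nat.add_sub_add_right, ← add_assoc]
    ring

theorem iteratedDeriv_ofReal_pow (m i : ℕ) (t : ℝ) :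
    iteratedDeriv i (fun r : ℝ => (r : ℂ) ^ m) t = m.descFactorial i * (t : ℂ) ^ (m - i) := by
  induction i generalizing t with
  | zero => simp
  | succ i ih =>
    rw [iteratedDeriv_succ, funext ih]
    have h2 := ((hasDerivAt_pow (m - i) t).ofReal_comp).const_mul (m.descFactorial i : ℂ)
    simp only [Complex.ofReal_pow] at h2
    rw [h2.deriv, Nat.descFactorial_succ, Nat.sub_sub]
    push_cast
    ring

theorem iteratedDeriv_pow_mul {u : ℝ → ℂ} (hu : ContDiffOn ℝ ∞ u (Ioi 0)) (m i : ℕ) {r : ℝ}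
    (hr : 0 < r) : iteratedDeriv i (fun r : ℝ => u r * (r : ℂ) ^ m) r =
      ∑ j ∈ Finset.range (i + 1), i.choose j * iteratedDeriv j u r *
        (m.descFactorial (i - j) * (r : ℂ) ^ (m - (i - j))) := by
  have h1 : ContDiffAt ℝ i u r :=
    (hu.contDiffAt (Ioi_mem_nhds hr)).of_le (by exact_mod_cast le_top)
  have h2 : ContDiffAt ℝ i (fun r : ℝ => (r : ℂ) ^ m) r :=
    (Complex.ofRealCLM.contDiff.pow m).contDiffAt
  rw [iteratedDeriv_fun_mul h1 h2]
  simp only [iteratedDeriv_ofReal_pow]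

-- Read off from the Taylor expansion at `1`: with `Z = X - 1`, `1 - X² = -Z (Z + 2)`.
open Polynomial in
theorem eval_one_iterate_derivative_bumpPoly (N i : ℕ) :
    (derivative^[N + i] (bumpPoly N)).eval 1 =
      (N + i).factorial * ((-1) ^ N * (2 ^ (N - i) * N.choose i)) := by
  rw [← factorial_smul_hasseDeriv, LinearMap.smul_apply, eval_smul, ← taylor_coeff, nsmul_eq_mul]
  congr 1
  have : taylor 1 (bumpPoly N) = C ((-1) ^ N) * (X ^ N * (X + C 2) ^ N) := by
    rw [bumpPoly, taylor_pow, ← mul_pow, C_pow, ← mul_pow]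
    congr 1
    simp only [map_sub, taylor_one, taylor_pow, taylor_X, map_one, map_neg, map_ofNat]
    ring
  rw [this, coeff_C_mul, add_comm N i, coeff_X_pow_mul, coeff_X_add_C_pow]

theorem iterate_derivative_bumpPoly_eq_zero (N : ℕ) :
    Polynomial.derivative^[2 * N + 1] (bumpPoly N) = 0 := by
  refine Polynomial.iterate_derivative_eq_zero ?_
  have h : (bumpPoly N).natDegree ≤ N * 2 := by
    unfold bumpPoly
    refine Polynomial.natDegree_pow_le_of_le N ?_
    compute_degree
  omega

end Derivatives

/-! ### Derivation of the differential equation. -/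

section Equation

open Polynomial

/-- The kernels obtained from `bumpPoly N` by applying the operator `D` under the integral. -/
def kernSeq (N : ℕ) (u : ℝ → ℂ) (j : ℕ) : ℝ → ℂ :=
  kern (derivative^[j] (bumpPoly N)) fun r =>
    (r : ℂ) ^ (2 * N + 1) * u r * ((-1 / r : ℝ) : ℂ) ^ j

/-- The boundary terms that appear when `D` is applied to `kernSeq`. -/
def bdryTerm (N : ℕ) (u : ℝ → ℂ) (j : ℕ) (t : ℝ) : ℂ :=
  ((1 / t : ℝ) : ℂ) * (((1 - t : ℝ) : ℂ) ^ (2 * N + 1) * u (1 - t) *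
    ((-1 / (1 - t) : ℝ) : ℂ) ^ j * (((derivative^[j] (bumpPoly N)).eval 1 : ℝ) : ℂ))

variable {N : ℕ} {u : ℝ → ℂ}

theorem hasDerivAt_kernSeq (hu : ContDiffOn ℝ ∞ u (Ioi 0)) (j : ℕ) {t : ℝ}
    (ht : t ∈ Ioo (0 : ℝ) 1) :
    HasDerivAt (kernSeq N u j) (t * (bdryTerm N u j t + kernSeq N u (j + 1) t)) t := by
  have hb : ContinuousOn (fun r : ℝ => (r : ℂ) ^ (2 * N + 1) * u r * ((-1 / r : ℝ) : ℂ) ^ j)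
      (Ioi 0) :=
    ((Continuous.continuousOn (by fun_prop)).mul hu.continuousOn).mul
      ((Complex.continuous_ofReal.comp_continuousOn continuousOn_neg_one_div).pow j)
  refine (hasDerivAt_kern _ hb ht.2).congr_deriv ?_
  have ht0 : (t : ℂ) ≠ 0 := Complex.ofReal_ne_zero.2 ht.1.ne'
  rw [mul_add]
  congr 1
  · rw [bdryTerm, ← mul_assoc (t : ℂ), Complex.ofReal_div 1 t, Complex.ofReal_one,
      mul_one_div_cancel ht0, one_mul]
  · rw [kernSeq, Function.iterate_succ_apply']
    congr 2
    funext r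
    rw [pow_succ _ j, ← mul_assoc]

theorem opD_kernSeq (hu : ContDiffOn ℝ ∞ u (Ioi 0)) (j : ℕ) {t : ℝ} (ht : t ∈ Ioo (0 : ℝ) 1) :
    opD (kernSeq N u j) t = bdryTerm N u j t + kernSeq N u (j + 1) t := by
  have ht0 : (t : ℂ) ≠ 0 := Complex.ofReal_ne_zero.2 ht.1.ne'
  rw [opD, (hasDerivAt_kernSeq hu j ht).deriv, ← mul_assoc, Complex.ofReal_div, Complex.ofReal_one,
    one_div_mul_cancel ht0, one_mul]

theorem iterate_opD_kernSeq_of_le (hu : ContDiffOn ℝ ∞ u (Ioi 0)) {q i : ℕ} (hi : q + i ≤ N) :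
    EqOn (opD^[i] (kernSeq N u q)) (kernSeq N u (q + i)) (Ioo 0 1) := by
  induction i with
  | zero => intro t _; rfl
  | succ i ih =>
    rw [Function.iterate_succ_apply']
    refine (opD_congr isOpen_Ioo (ih (by omega))).trans fun t ht => ?_
    rw [opD_kernSeq hu _ ht, bdryTerm,
      eval_iterate_derivative_bumpPoly (by omega) (by norm_num)]
    simp [add_assoc]

theorem contDiffOn_comp_one_sub (hu : ContDiffOn ℝ ∞ u (Ioi 0)) :
    ContDiffOn ℝ ∞ (fun t => u (1 - t)) (Ioo 0 1) :=
  hu.comp (contDiffOn_const.sub contDiffOn_id) fun _ ht => sub_pos.2 ht.2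

theorem contDiffOn_bdryTerm (hu : ContDiffOn ℝ ∞ u (Ioi 0)) (j : ℕ) :
    ContDiffOn ℝ ∞ (bdryTerm N u j) (Ioo 0 1) := by
  unfold bdryTerm
  have h1 : ContDiffOn ℝ ∞ (fun t : ℝ => 1 - t) (Ioo 0 1) := contDiffOn_const.sub contDiffOn_id
  have h2 : ContDiffOn ℝ ∞ (fun t : ℝ => ((1 / t : ℝ) : ℂ)) (Ioo 0 1) :=
    Complex.ofRealCLM.contDiff.comp_contDiffOn
      (contDiffOn_const.div contDiffOn_id fun t ht => ht.1.ne')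
  have h3 : ContDiffOn ℝ ∞ (fun t : ℝ => ((-1 / (1 - t) : ℝ) : ℂ)) (Ioo 0 1) :=
    Complex.ofRealCLM.contDiff.comp_contDiffOn
      (contDiffOn_const.div h1 fun t ht => (sub_pos.2 ht.2).ne')
  have h4 : ContDiffOn ℝ ∞ (fun t : ℝ => ((1 - t : ℝ) : ℂ)) (Ioo 0 1) :=
    Complex.ofRealCLM.contDiff.comp_contDiffOn h1
  exact h2.mul ((((h4.pow _).mul (contDiffOn_comp_one_sub hu)).mul (h3.pow j)).mul contDiffOn_const)

/-- The boundary term created at step `j` is differentiated by the `i - 1 - j` remaining steps. -/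
theorem iterate_opD_kernSeq (hu : ContDiffOn ℝ ∞ u (Ioi 0)) (q i : ℕ) :
    EqOn (opD^[i] (kernSeq N u q)) (fun t => kernSeq N u (q + i) t +
      ∑ j ∈ Finset.range i, opD^[i - 1 - j] (bdryTerm N u (q + j)) t) (Ioo 0 1) := by
  induction i with
  | zero => intro t _; simp
  | succ i ih =>
    rw [Function.iterate_succ_apply']
    refine (opD_congr isOpen_Ioo ih).trans fun t ht => ?_
    have hd : ∀ j ∈ Finset.range i, HasDerivAt (opD^[i - 1 - j] (bdryTerm N u (q + j)))
        (deriv (opD^[i - 1 - j] (bdryTerm N u (q + j))) t) t := fun j _ =>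
      (((contDiffOn_iterate_opD (contDiffOn_bdryTerm hu (q + j)) _).differentiableOn
        (by simp)).differentiableAt (isOpen_Ioo.mem_nhds ht)).hasDerivAt
    have h := (hasDerivAt_kernSeq (N := N) hu (q + i) ht).fun_add (HasDerivAt.fun_sum hd)
    have ht0 : (t : ℂ) ≠ 0 := Complex.ofReal_ne_zero.2 ht.1.ne'
    rw [opD, h.deriv, mul_add, ← mul_assoc, Complex.ofReal_div, Complex.ofReal_one,
      one_div_mul_cancel ht0, one_mul, Finset.sum_range_succ, Finset.mul_sum]
    have e : ∀ j ∈ Finset.range i, 1 / (t : ℂ) * deriv (opD^[i - 1 - j] (bdryTerm N u (q + j))) t =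
        opD^[i + 1 - 1 - j] (bdryTerm N u (q + j)) t := fun j hj => by
      have hj' := Finset.mem_range.1 hj
      rw [show i + 1 - 1 - j = (i - 1 - j) + 1 by omega, Function.iterate_succ_apply', opD,
        Complex.ofReal_div, Complex.ofReal_one]
    rw [Finset.sum_congr rfl e]
    simp [add_assoc]
    ring

theorem kernSeq_last (N : ℕ) (u : ℝ → ℂ) (t : ℝ) : kernSeq N u (2 * N + 1) t = 0 := by
  rw [kernSeq, iterate_derivative_bumpPoly_eq_zero]
  simp [kern]

/-- The exponent splits as `k + (N + 1)`: the first `k` steps leave no boundary term, and the last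
ones end at the derivative of order `2N + 1`, which is zero. The sum is indexed by `l = N - j`, the
number of remaining steps. -/
theorem iterate_opD_kernSeq_top (hu : ContDiffOn ℝ ∞ u (Ioi 0)) {q k : ℕ} (hN : q + k = N) {t : ℝ}
    (ht : t ∈ Ioo (0 : ℝ) 1) :
    opD^[q + 2 * k + 1] (kernSeq N u q) t =
      ∑ l ∈ Finset.range (N + 1), opD^[l] (bdryTerm N u (2 * N - l)) t := by
  have e : q + 2 * k + 1 = (N + 1) + k := by omega
  rw [e, Function.iterate_add_apply]
  have h := iterate_opD_congr isOpen_Ioo (iterate_opD_kernSeq_of_le hu (N := N) (q := q) (i := k)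
    (by omega)) (N + 1) ht
  rw [h, hN, iterate_opD_kernSeq hu N (N + 1) ht, show N + (N + 1) = 2 * N + 1 by ring]
  dsimp only
  rw [kernSeq_last, zero_add,
    ← Finset.sum_range_reflect (fun l => opD^[l] (bdryTerm N u (2 * N - l)) t)]
  refine Finset.sum_congr rfl fun j hj => ?_
  have := Finset.mem_range.1 hj
  rw [show 2 * N - (N + 1 - 1 - j) = N + j by omega]

/-- The `2N - l` factors `-1/(1 - t)` reduce `(1 - t)^(2N + 1)` to `(1 - t)^(l + 1)`, which leaves
the form `φ/t` needed for `iterate_opD_div`. -/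
theorem bdryTerm_eqOn (u : ℝ → ℂ) {l : ℕ} (hl : l ≤ N) :
    EqOn (bdryTerm N u (2 * N - l)) (fun t => ((-1) ^ (N + l) * (2 * N - l).factorial * 2 ^ l *
      N.choose l : ℂ) * (u (1 - t) * (((1 - t : ℝ) : ℂ) ^ (l + 1)) / (t : ℂ))) (Ioo 0 1) := by
  intro t ht
  have h1 : (1 - t : ℂ) ≠ 0 := by
    exact_mod_cast Complex.ofReal_ne_zero.2 (sub_pos.2 ht.2).ne'
  obtain ⟨d, rfl⟩ := Nat.exists_eq_add_of_le hl
  have e : 2 * (l + d) - l = (l + d) + d := by omega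
  have e2 : 2 * (l + d) + 1 = (l + d + d) + (l + 1) := by ring
  rw [bdryTerm, e, eval_one_iterate_derivative_bumpPoly, e2, Nat.add_sub_cancel,
    show (l + d).choose d = (l + d).choose l from (Nat.choose_symm_add).symm, pow_add _ (l + d + d)]
  have h3 : (-1 : ℂ) ^ (l + d + d) = (-1) ^ (l + d + l) * (-1) ^ (l + d) := by
    have h4 : (-1 : ℂ) ^ (l + l) = 1 := (Even.add_self l).neg_one_pow
    have h5 : (-1 : ℂ) ^ (d + d) = 1 := (Even.add_self d).neg_one_pow
    rw [add_assoc l d d, pow_add, h5, ← pow_add,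
      show l + d + l + (l + d) = (l + l) + (d + d) + l by ring, pow_add, pow_add, h4, h5]
    ring
  have h6 : (-1 : ℂ) ^ (l + d) * (-1) ^ (l + d) = 1 := by
    rw [← pow_add]; exact (Even.add_self _).neg_one_pow
  push_cast
  rw [div_pow, h3]
  field_simp
  linear_combination (u (1 - t) * (l + d + d).factorial * (l + d).choose l * (t : ℂ)⁻¹) * h6

theorem iterate_opD_bdryTerm (hu : ContDiffOn ℝ ∞ u (Ioi 0)) {l : ℕ} (hl : l ≤ N) {t : ℝ}
    (ht : t ∈ Ioo (0 : ℝ) 1) :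
    opD^[l] (bdryTerm N u (2 * N - l)) t =
      ((-1) ^ (N + l) * (2 * N - l).factorial * 2 ^ l * N.choose l : ℂ) *
        ∑ a ∈ Finset.range (l + 1), ∑ m ∈ Finset.range (l - a + 1),
          besselCoeff l a * (-1) ^ (l - a) * (l - a).choose m * (l + 1).descFactorial (l - a - m) *
            ((1 - t : ℂ) ^ (l + 1 - (l - a - m)) / (t : ℂ) ^ (l + a + 1)) *
              iteratedDeriv m u (1 - t) := by
  have h1t : (0 : ℝ) < 1 - t := sub_pos.2 ht.2
  have hv : ContDiffOn ℝ ∞ (fun r : ℝ => u r * (r : ℂ) ^ (l + 1)) (Ioi 0) :=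
    hu.mul (Complex.ofRealCLM.contDiff.pow _).contDiffOn
  rw [iterate_opD_congr isOpen_Ioo (bdryTerm_eqOn u hl) l ht, iterate_opD_const_mul]
  dsimp only
  rw [iterate_opD_div (φ := fun t => u (1 - t) * (((1 - t : ℝ) : ℂ) ^ (l + 1)))
    (contDiffOn_comp_one_sub hv) l ht]
  congr 1
  refine Finset.sum_congr rfl fun a _ => ?_
  rw [iteratedDeriv_comp_const_sub (f := fun r : ℝ => u r * (r : ℂ) ^ (l + 1))]
  dsimp only
  rw [iteratedDeriv_pow_mul hu _ _ h1t, Complex.real_smul, Finset.mul_sum, Finset.sum_div,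
    Finset.mul_sum]
  refine Finset.sum_congr rfl fun m _ => ?_
  push_cast
  ring

theorem bessel_coeff_identity {N l a m : ℕ} (hl : l ≤ N) (ha : a ≤ l) (hm : m ≤ l - a) :
    ((-1) ^ (N + l) * (2 * N - l).factorial * 2 ^ l * N.choose l : ℂ) *
      (besselCoeff l a * (-1) ^ (l - a) * (l - a).choose m * (l + 1).descFactorial (l - a - m)) =
    (-1) ^ N * N.factorial * (2 ^ (l - a) * ((2 * N - l).factorial / ((N - l).factorial *
      m.factorial)) * (l + 1).choose (m + a + 1) * (l + a).choose a) := by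
  obtain ⟨e, rfl⟩ := Nat.exists_eq_add_of_le hl
  -- With `l = a + m + d` and `N = l + e` every subtraction disappears except `2N - l`, whose
  -- factorial is common to both sides. All the rest is written in factorials.
  obtain ⟨d, rfl⟩ : ∃ d, l = a + (m + d) := ⟨l - a - m, by omega⟩
  have hb := besselCoeff_add a (m + d)
  have c1 := Nat.choose_mul_factorial_mul_factorial
    (show a + (m + d) ≤ a + (m + d) + e by omega)
  have c2 := Nat.choose_mul_factorial_mul_factorial (show m ≤ m + d by omega)
  have c3 := Nat.choose_mul_factorial_mul_factorial (show m + a + 1 ≤ a + (m + d) + 1 by omega)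
  have c4 := Nat.choose_mul_factorial_mul_factorial (show a ≤ a + (m + d) + a by omega)
  rw [Nat.add_sub_cancel_left] at c1 c2
  rw [show a + (m + d) + 1 - (m + a + 1) = d by omega] at c3
  rw [Nat.add_sub_cancel] at c4
  have c5 := Nat.factorial_mul_descFactorial (show d ≤ a + (m + d) + 1 by omega)
  rw [show a + (m + d) + 1 - d = m + a + 1 by omega] at c5
  rw [show a + (m + d) - a = m + d by omega, show m + d - m = d by omega,
    show a + (m + d) + e - (a + (m + d)) = e by omega]
  generalize 2 * (a + (m + d) + e) - (a + (m + d)) = M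
  have hs : (-1 : ℂ) ^ (a + (m + d) + e + (a + (m + d))) * (-1) ^ (m + d) * (-1) ^ a =
      (-1) ^ (a + (m + d) + e) := by
    rw [← pow_add, ← pow_add,
      show a + (m + d) + e + (a + (m + d)) + (m + d) + a = a + (m + d) + e + (2 * (a + (m + d))) by
        ring, pow_add, pow_mul (-1 : ℂ) 2]
    simp
  have f0 : ∀ i : ℕ, (i.factorial : ℂ) ≠ 0 := fun i => by exact_mod_cast (Nat.factorial_pos i).ne'
  have d1 : ((a + (m + d) + e).choose (a + (m + d)) : ℂ) =
      (a + (m + d) + e).factorial / ((a + (m + d)).factorial * e.factorial) := by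
    rw [eq_div_iff (mul_ne_zero (f0 _) (f0 _)), ← mul_assoc]; exact_mod_cast c1
  have d2 : ((m + d).choose m : ℂ) = (m + d).factorial / (m.factorial * d.factorial) := by
    rw [eq_div_iff (mul_ne_zero (f0 _) (f0 _)), ← mul_assoc]; exact_mod_cast c2
  have d3 : ((a + (m + d) + 1).choose (m + a + 1) : ℂ) =
      (a + (m + d) + 1).factorial / ((m + a + 1).factorial * d.factorial) := by
    rw [eq_div_iff (mul_ne_zero (f0 _) (f0 _)), ← mul_assoc]; exact_mod_cast c3
  have d4 : ((a + (m + d) + a).choose a : ℂ) =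
      (a + (m + d) + a).factorial / (a.factorial * (a + (m + d)).factorial) := by
    rw [eq_div_iff (mul_ne_zero (f0 _) (f0 _)), ← mul_assoc]; exact_mod_cast c4
  have d5 : ((a + (m + d) + 1).descFactorial d : ℂ) =
      (a + (m + d) + 1).factorial / (m + a + 1).factorial := by
    rw [eq_div_iff (f0 _), mul_comm]; exact_mod_cast c5
  have d6 : besselCoeff (a + (m + d)) a =
      (-1) ^ a * (a + (m + d) + a).factorial / (2 ^ a * a.factorial * (m + d).factorial) := by
    rw [eq_div_iff (mul_ne_zero (mul_ne_zero (pow_ne_zero _ two_ne_zero) (f0 _)) (f0 _))]; exact hb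
  rw [d1, d2, d3, d4, d5, d6, ← hs, pow_add (2 : ℂ) a]
  have := f0 (m + d)
  have := f0 e
  have := f0 m
  have := f0 d
  have := f0 a
  have := f0 (m + a + 1)
  have := f0 (a + (m + d))
  field_simp

/-- Substitution `ν = m + a`: `m` counts derivatives of `u`, and `a` is the Bessel index. -/
theorem sum_reindex (N : ℕ) (F : ℕ → ℕ → ℕ → ℂ) :
    ∑ m ∈ Finset.range (N + 1), ∑ ν ∈ Finset.Icc m N, ∑ l ∈ Finset.Icc ν N, F m ν l =
      ∑ l ∈ Finset.range (N + 1), ∑ a ∈ Finset.range (l + 1), ∑ m ∈ Finset.range (l - a + 1),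
        F m (m + a) l := by
  simp only [Finset.sum_sigma']
  refine Finset.sum_bij' (fun x _ => ⟨x.2.2, ⟨x.2.1 - x.1, x.1⟩⟩)
    (fun y _ => ⟨y.2.2, ⟨y.2.2 + y.2.1, y.1⟩⟩) ?_ ?_ ?_ ?_ ?_
  · rintro ⟨m, ν, l⟩ h
    simp only [Finset.mem_sigma, Finset.mem_range, Finset.mem_Icc] at h ⊢
    omega
  · rintro ⟨l, a, m⟩ h
    simp only [Finset.mem_sigma, Finset.mem_range, Finset.mem_Icc] at h ⊢
    omega
  · rintro ⟨m, ν, l⟩ h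
    simp only [Finset.mem_sigma, Finset.mem_range, Finset.mem_Icc] at h
    simp only [Nat.add_sub_cancel' h.2.1.1]
  · rintro ⟨l, a, m⟩ h
    simp only [Nat.add_sub_cancel_left]
  · rintro ⟨m, ν, l⟩ h
    simp only [Finset.mem_sigma, Finset.mem_range, Finset.mem_Icc] at h
    simp only [Nat.add_sub_cancel' h.2.1.1]

theorem odeRHS_eq_sum (q k : ℕ) (y : ℝ → ℂ) (t : ℝ) :
    odeRHS q k y t = ((-1) ^ (q + k) * k.factorial / 2 ^ q : ℂ) *
      ∑ l ∈ Finset.range (q + k + 1), ∑ a ∈ Finset.range (l + 1), ∑ m ∈ Finset.range (l - a + 1),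
        (2 ^ (l - a) * ((2 * (q + k) - l).factorial / ((q + k - l).factorial *
          m.factorial)) * (l + 1).choose (m + a + 1) * (l + a).choose a : ℂ) *
            ((1 - t : ℂ) ^ (m + a + 1) / (t : ℂ) ^ (l + a)) * iteratedDeriv m y (1 - t) := by
  have h := sum_reindex (q + k) fun m ν l =>
    ((2 ^ (l + m - ν) * ((2 * q + 2 * k - l).factorial / ((q + k - l).factorial * m.factorial)) *
      (l + 1).choose (ν + 1) * (l + ν - m).choose (ν - m) * (1 / t ^ l) *
        ((1 - t) ^ (ν + 1) / t ^ (ν - m)) : ℝ) : ℂ) * iteratedDeriv m y (1 - t)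
  unfold odeRHS odeCoeff
  congr 1
  · push_cast; rfl
  · simp only [Complex.ofReal_sum, Finset.sum_mul]
    rw [h]
    refine Finset.sum_congr rfl fun l hl => Finset.sum_congr rfl fun a ha =>
      Finset.sum_congr rfl fun m hm => ?_
    have ha' := Finset.mem_range.1 ha
    rw [show l + m - (m + a) = l - a by omega, show l + (m + a) - m = l + a by omega,
      show m + a - m = a by omega, show 2 * q + 2 * k = 2 * (q + k) by ring, pow_add _ l a]
    push_cast
    ring

theorem odeLHS_kernSeq (hu : ContDiffOn ℝ ∞ u (Ioi 0)) {q k : ℕ} {h : ℝ → ℂ}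
    (hh : EqOn h (fun t => (k.factorial / (2 ^ q * (q + k).factorial) : ℂ) *
      kernSeq (q + k) u q t) (Ioo 0 1)) {t : ℝ} (ht : t ∈ Ioo (0 : ℝ) 1) :
    odeLHS q k h t = odeRHS q k u t := by
  have ht0 : (t : ℂ) ≠ 0 := Complex.ofReal_ne_zero.2 ht.1.ne'
  -- The outermost `d/dt` is `t D`.
  have h1 : odeLHS q k h t = t * opD^[q + 2 * k + 1] h t := by
    rw [Function.iterate_succ_apply', opD, ← mul_assoc, Complex.ofReal_div, Complex.ofReal_one,
      mul_one_div_cancel ht0, one_mul, odeLHS]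
  rw [h1, iterate_opD_congr isOpen_Ioo hh _ ht, iterate_opD_const_mul]
  dsimp only
  rw [iterate_opD_kernSeq_top hu rfl ht, odeRHS_eq_sum, Finset.mul_sum, Finset.mul_sum,
    Finset.mul_sum]
  refine Finset.sum_congr rfl fun l hl => ?_
  have hl' : l ≤ q + k := Nat.lt_succ_iff.1 (Finset.mem_range.1 hl)
  rw [iterate_opD_bdryTerm hu hl' ht]
  simp only [Finset.mul_sum]
  refine Finset.sum_congr rfl fun a ha => Finset.sum_congr rfl fun m hm => ?_
  have ha' : a ≤ l := Nat.lt_succ_iff.1 (Finset.mem_range.1 ha)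
  have hm' : m ≤ l - a := Nat.lt_succ_iff.1 (Finset.mem_range.1 hm)
  have key := bessel_coeff_identity hl' ha' hm'
  rw [show l + 1 - (l - a - m) = m + a + 1 by omega]
  have hf : ((q + k).factorial : ℂ) ≠ 0 := by exact_mod_cast (Nat.factorial_pos _).ne'
  have e : ((-1) ^ (q + k) * k.factorial / 2 ^ q : ℂ) = (k.factorial / (2 ^ q *
      (q + k).factorial) : ℂ) * ((-1) ^ (q + k) * (q + k).factorial) := by
    field_simp
  rw [e]
  have e2 : (t : ℂ) ^ (l + a + 1) = t ^ (l + a) * t := pow_succ _ _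
  rw [e2]
  calc _ = (k.factorial / (2 ^ q * (q + k).factorial) : ℂ) *
        (((-1) ^ (q + k + l) * (2 * (q + k) - l).factorial * 2 ^ l * (q + k).choose l : ℂ) *
          (besselCoeff l a * (-1) ^ (l - a) * (l - a).choose m *
            (l + 1).descFactorial (l - a - m))) *
        (t * ((1 - t : ℂ) ^ (m + a + 1) / (t ^ (l + a) * t))) * iteratedDeriv m u (1 - t) := by
        ring
    _ = _ := by
        rw [key]
        have : (t : ℂ) * ((1 - t : ℂ) ^ (m + a + 1) / (t ^ (l + a) * t)) =
            (1 - t : ℂ) ^ (m + a + 1) / t ^ (l + a) := by field_simp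
        rw [this]
        ring

end Equation

/-! ### Uniqueness for the initial value problem. -/

section Uniqueness

/-- Uniqueness for linear ordinary differential equations of order `N` with continuous
coefficients and nonvanishing leading coefficient. -/
theorem linear_ode_unique {N : ℕ} {α β : ℝ} {c : ℕ → ℝ → ℂ}
    (hc : ∀ m, ContinuousOn (c m) (Ioo α β)) (hlead : ∀ r ∈ Ioo α β, c N r ≠ 0) {y z : ℝ → ℂ}
    (hy : ContDiffOn ℝ N y (Ioo α β)) (hz : ContDiffOn ℝ N z (Ioo α β))
    (hyz : ∀ r ∈ Ioo α β, ∑ m ∈ Finset.range (N + 1), c m r * iteratedDeriv m y r =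
      ∑ m ∈ Finset.range (N + 1), c m r * iteratedDeriv m z r) {r₀ : ℝ} (hr₀ : r₀ ∈ Ioo α β)
    (h₀ : ∀ i < N, iteratedDeriv i y r₀ = iteratedDeriv i z r₀) : EqOn y z (Ioo α β) := by
  intro r hr
  rcases Nat.eq_zero_or_pos N with rfl | hN
  · simpa [hlead r hr] using hyz r hr
  -- A compact subinterval around `r` and `r₀`, on which the normalized coefficients are bounded;
  -- this gives one Lipschitz constant for the system.
  set a := (α + min r r₀) / 2 with ha
  set b := (max r r₀ + β) / 2 with hb
  have hmin : α < min r r₀ := lt_min hr.1 hr₀.1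
  have hmax : max r r₀ < β := max_lt hr.2 hr₀.2
  have hsub : Icc a b ⊆ Ioo α β := fun s hs =>
    ⟨by linarith [hs.1], by linarith [hs.2]⟩
  have hin : ∀ s, min r r₀ ≤ s → s ≤ max r r₀ → s ∈ Ioo a b := fun s h1 h2 =>
    ⟨by linarith, by linarith⟩
  have hK : ∀ m, ∃ K : ℝ, ∀ s ∈ Icc a b, ‖c m s / c N s‖ ≤ K := fun m =>
    isCompact_Icc.exists_bound_of_continuousOn
      (((hc m).mono hsub).div ((hc N).mono hsub) fun s hs => hlead s (hsub hs))
  choose K hK using hK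
  have hab : (a + b) / 2 ∈ Icc a b := by
    have : min r r₀ ≤ max r r₀ := min_le_max
    constructor <;> linarith
  have hK0 : ∀ m, 0 ≤ K m := fun m => (norm_nonneg _).trans (hK m _ hab)
  set S : ℝ := ∑ m : Fin N, K m with hS
  have hS0 : 0 ≤ S := Finset.sum_nonneg fun m _ => hK0 m
  -- The inhomogeneity is read off from `y`; by `hyz` it is the same for `z`. Then `v` is the
  -- companion first-order system for the vector of derivatives of order below `N`.
  let B : ℝ → ℂ := fun s => (∑ m ∈ Finset.range (N + 1), c m s * iteratedDeriv m y s) / c N s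
  let v : ℝ → (Fin N → ℂ) → Fin N → ℂ := fun s Z i =>
    if h : (i : ℕ) + 1 < N then Z ⟨i + 1, h⟩ else B s - ∑ m : Fin N, c m s / c N s * Z m
  have hv : ∀ s ∈ Ioo a b, LipschitzOnWith (Real.toNNReal (1 + S)) (v s) univ := fun s hs => by
    refine LipschitzOnWith.of_dist_le_mul fun Z _ W _ => ?_
    rw [Real.coe_toNNReal _ (by positivity), dist_pi_le_iff (by positivity)]
    intro i
    simp only [v]
    split_ifs with h
    · calc dist (Z ⟨i + 1, h⟩) (W ⟨i + 1, h⟩) ≤ dist Z W := dist_le_pi_dist Z W _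
        _ ≤ (1 + S) * dist Z W := by nlinarith [dist_nonneg (x := Z) (y := W)]
    · rw [dist_sub_left, dist_eq_norm, ← Finset.sum_sub_distrib]
      calc ‖∑ m : Fin N, (c m s / c N s * Z m - c m s / c N s * W m)‖
          ≤ ∑ m : Fin N, K m * dist Z W := by
            refine norm_sum_le_of_le _ fun m _ => ?_
            rw [← mul_sub, norm_mul, ← dist_eq_norm (Z m)]
            exact mul_le_mul (hK m s ⟨hs.1.le, hs.2.le⟩) (dist_le_pi_dist Z W m) dist_nonneg
              (hK0 m)
        _ = S * dist Z W := by rw [← Finset.sum_mul]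
        _ ≤ (1 + S) * dist Z W := by nlinarith [dist_nonneg (x := Z) (y := W)]
  have hsol : ∀ φ : ℝ → ℂ, ContDiffOn ℝ N φ (Ioo α β) →
      (∀ s ∈ Ioo α β, ∑ m ∈ Finset.range (N + 1), c m s * iteratedDeriv m y s =
        ∑ m ∈ Finset.range (N + 1), c m s * iteratedDeriv m φ s) → ∀ s ∈ Ioo a b,
      HasDerivAt (fun s (i : Fin N) => iteratedDeriv i φ s)
        (v s fun i : Fin N => iteratedDeriv i φ s) s ∧
          (fun i : Fin N => iteratedDeriv i φ s) ∈ (univ : Set (Fin N → ℂ)) := by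
    intro φ hφ hφe s hs
    refine ⟨hasDerivAt_pi.2 fun i => ?_, mem_univ _⟩
    have hs' : s ∈ Ioo α β := hsub ⟨hs.1.le, hs.2.le⟩
    refine (hasDerivAt_iteratedDeriv isOpen_Ioo hφ (by exact_mod_cast i.2) hs').congr_deriv ?_
    simp only [v]
    split_ifs with h
    · rfl
    · have hi : (i : ℕ) + 1 = N := by have := i.2; omega
      have hl := hlead s hs'
      simp only [B]
      rw [hφe s hs', Finset.sum_range_succ, hi, add_div, mul_div_cancel_left₀ _ hl,
        Finset.sum_div, Finset.sum_range]
      have : ∀ m : Fin N, c m s * iteratedDeriv m φ s / c N s =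
        c m s / c N s * iteratedDeriv m φ s := fun m => by ring
      simp only [this]
      ring
  have hmain := ODE_solution_unique_of_mem_Ioo (s := fun _ => univ) hv
    (hin r₀ (min_le_right _ _) (le_max_right _ _)) (hsol y hy fun _ _ => rfl) (hsol z hz hyz)
    (funext fun i => h₀ i i.2)
  have := congrFun (hmain (hin r (min_le_left _ _) (le_max_left _ _))) ⟨0, hN⟩
  simpa using this

theorem continuousOn_odeCoeff (q k m : ℕ) : ContinuousOn (odeCoeff q k m) (Ioi 0) := by
  unfold odeCoeff
  refine continuousOn_finsetSum _ fun ν _ => continuousOn_finsetSum _ fun l _ => ?_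
  refine ContinuousOn.mul (ContinuousOn.mul continuousOn_const ?_) ?_
  · exact continuousOn_const.div (by fun_prop) fun t ht => pow_ne_zero _ (ne_of_gt ht)
  · exact ContinuousOn.div (by fun_prop) (by fun_prop) fun t ht => pow_ne_zero _ (ne_of_gt ht)

/-- For `m = q + k` only `ν = l = q + k` occurs, and that single term is positive. -/
theorem odeCoeff_lead_ne_zero (q k : ℕ) {t : ℝ} (ht : t ∈ Ioo (0 : ℝ) 1) :
    odeCoeff q k (q + k) t ≠ 0 := by
  have h1 : 0 < t := ht.1
  have h2 : 0 < 1 - t := sub_pos.2 ht.2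
  unfold odeCoeff
  simp only [Finset.Icc_self, Finset.sum_singleton, Nat.choose_self, Nat.sub_self,
    Nat.add_sub_cancel, Nat.choose_zero_right]
  positivity

theorem eqOn_of_odeRHS_eq {q k : ℕ} {α : ℝ} (hα : 0 < α) {y z : ℝ → ℂ}
    (hy : ContDiffOn ℝ ((q + k : ℕ) : WithTop ℕ∞) y (Ioo α 1))
    (hz : ContDiffOn ℝ ((q + k : ℕ) : WithTop ℕ∞) z (Ioo α 1))
    (hyz : ∀ t ∈ Ioo (0 : ℝ) (1 - α), odeRHS q k y t = odeRHS q k z t) {r₀ : ℝ}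
    (hr₀ : r₀ ∈ Ioo α 1) (h₀ : ∀ i < q + k, iteratedDeriv i y r₀ = iteratedDeriv i z r₀) :
    EqOn y z (Ioo α 1) := by
  have hmem : ∀ r ∈ Ioo α 1, 1 - r ∈ Ioo (0 : ℝ) 1 := fun r hr =>
    ⟨by linarith [hr.2], by linarith [hr.1]⟩
  refine linear_ode_unique (c := fun m r => ((odeCoeff q k m (1 - r) : ℝ) : ℂ)) (fun m => ?_)
    (fun r hr => ?_) hy hz (fun r hr => ?_) hr₀ h₀
  · exact Complex.continuous_ofReal.comp_continuousOn ((continuousOn_odeCoeff q k m).comp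
      (by fun_prop) fun r hr => (hmem r hr).1)
  · exact Complex.ofReal_ne_zero.2 (odeCoeff_lead_ne_zero q k (hmem r hr))
  · have h := hyz (1 - r) ⟨by linarith [hr.2], by linarith [hr.1]⟩
    rw [odeRHS, odeRHS, sub_sub_cancel] at h
    refine mul_left_cancel₀ (Complex.ofReal_ne_zero.2 ?_) h
    have : (k.factorial : ℝ) ≠ 0 := by positivity
    exact div_ne_zero (mul_ne_zero (pow_ne_zero _ (by norm_num)) this) (by positivity)

theorem odeRHS_congr {q k : ℕ} {y z : ℝ → ℂ} {U : Set ℝ} (hU : IsOpen U) (hyz : EqOn y z U) {t : ℝ}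
    (ht : 1 - t ∈ U) : odeRHS q k y t = odeRHS q k z t := by
  unfold odeRHS
  congr 1
  exact Finset.sum_congr rfl fun m _ => by rw [hyz.iteratedDeriv_of_isOpen hU m ht]

end Uniqueness

/-! ### Application to the spherical-harmonic coefficients. -/

section Main

variable {k q : ℕ} {f : Eucl (2 * k + 3) → ℂ} {Y : USphere (2 * k + 3) → ℂ}

/-- Dividing the coefficient by `r^q` makes the weights match: `r^(2(q + k) + 1) r^(-q) (-1/r)^q =
(-1)^q r^(2k + 1)`, and the sign cancels the one in Rodrigues' formula. -/
theorem dataH_eq_kernSeq (hf : ContDiff ℝ ∞ f) (hfc : HasCompactSupport f)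
    (hfB : tsupport f ⊆ ball (0 : Eucl (2 * k + 3)) 1)
    (hY : IsSphericalHarmonic (2 * k + 3) q Y) :
    EqOn (dataH (2 * k + 3) k f Y) (fun t => (k.factorial / (2 ^ q * (q + k).factorial) : ℂ) *
      kernSeq (q + k) (coeffFTilde (2 * k + 3) q f Y) q t) (Ioo 0 1) := by
  intro t ht
  rw [dataH_eq_kern hf hfc hfB hY ht, zonalPoly, kern_C_mul, kernSeq]
  have h : kern (Polynomial.derivative^[q] (bumpPoly (q + k))) (fun r : ℝ =>
      (r : ℂ) ^ (2 * (q + k) + 1) * coeffFTilde (2 * k + 3) q f Y r * ((-1 / r : ℝ) : ℂ) ^ q) t =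
      (-1) ^ q * kern (Polynomial.derivative^[q] (bumpPoly (q + k)))
        (fun r : ℝ => (r : ℂ) ^ (2 * k + 1) * coeffF (2 * k + 3) f Y r) t := by
    rw [← kern_const_mul]
    refine kern_congr _ (fun r hr => ?_) ht.2
    have hr0 : (r : ℂ) ≠ 0 := Complex.ofReal_ne_zero.2 (ne_of_gt hr)
    simp only [coeffFTilde]
    push_cast
    rw [div_pow, show 2 * (q + k) + 1 = q + q + (2 * k + 1) by ring, pow_add, pow_add]
    field_simp
  dsimp only
  rw [h]
  push_cast
  ring

/-- The radii met by the compact support form a closed set, so missing one sphere means missing all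
nearby ones. Vanishing on a neighbourhood kills the derivatives of every order at `ρ`. -/
theorem coeffFTilde_eventually_zero {n q : ℕ} {f : Eucl n → ℂ} (hfc : HasCompactSupport f)
    (Y : USphere n → ℂ) {ρ : ℝ} (hρ : 0 < ρ)
    (hd : Disjoint (sphere (0 : Eucl n) ρ) (tsupport f)) :
    coeffFTilde n q f Y =ᶠ[nhds ρ] fun _ => 0 := by
  have hR : IsClosed (norm '' tsupport f) := (hfc.isCompact.image continuous_norm).isClosed
  have hρR : ρ ∉ norm '' tsupport f := by
    rintro ⟨x, hx, rfl⟩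
    exact Set.disjoint_left.1 hd (mem_sphere_zero_iff_norm.2 rfl) hx
  filter_upwards [hR.isOpen_compl.mem_nhds hρR, Ioi_mem_nhds hρ] with r hr hr0
  have : coeffF n f Y r = 0 := by
    unfold coeffF
    refine integral_eq_zero_of_ae (.of_forall fun θ => ?_)
    have : r • (θ : Eucl n) ∉ tsupport f := fun h => hr ⟨_, h, by
      rw [norm_smul, norm_eq_of_mem_sphere, mul_one, Real.norm_of_nonneg (le_of_lt hr0)]⟩
    simp [image_eq_zero_of_notMem_tsupport this]
  rw [coeffFTilde, this, zero_div]

theorem exists_sphere_disjoint_tsupport {n : ℕ} {f : Eucl n → ℂ} (hfc : HasCompactSupport f)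
    (hfB : tsupport f ⊆ ball (0 : Eucl n) 1) :
    ∃ δ : ℝ, 0 < δ ∧ ∀ ε' : ℝ, 0 < ε' → ε' < δ →
      Disjoint (sphere (0 : Eucl n) (1 - ε')) (tsupport f) := by
  rcases (tsupport f).eq_empty_or_nonempty with h | h
  · exact ⟨1, one_pos, fun _ _ _ => by rw [h]; exact Set.disjoint_empty _⟩
  · obtain ⟨x, hx, hmax⟩ := hfc.isCompact.exists_isMaxOn h continuous_norm.continuousOn
    have hx1 : ‖x‖ < 1 := mem_ball_zero_iff.1 (hfB hx)
    refine ⟨1 - ‖x‖, sub_pos.2 hx1, fun ε' _ hε' => Set.disjoint_left.2 fun z hz hz' => ?_⟩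
    have h1 : ‖z‖ ≤ ‖x‖ := hmax hz'
    rw [mem_sphere_zero_iff_norm.1 hz] at h1
    linarith

theorem solvesIVP_iff (hf : ContDiff ℝ ∞ f) (hfc : HasCompactSupport f)
    (hfB : tsupport f ⊆ ball (0 : Eucl (2 * k + 3)) 1)
    (hY : IsSphericalHarmonic (2 * k + 3) q Y) {ε ε' : ℝ} (hε : 0 < ε) (hε' : 0 < ε')
    (hεε' : ε < 1 - ε') (hd : Disjoint (sphere (0 : Eucl (2 * k + 3)) (1 - ε')) (tsupport f))
    (y : ℝ → ℂ) :
    SolvesIVP q k (dataH (2 * k + 3) k f Y) ε ε' y ↔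
      EqOn y (coeffFTilde (2 * k + 3) q f Y) (Ioo ε 1) := by
  have hu := contDiffOn_coeffFTilde (q := q) hf hY.continuous
  have hsub : Ioo ε 1 ⊆ Ioi 0 := fun r hr => hε.trans hr.1
  have huN : ContDiffOn ℝ ((q + k : ℕ) : WithTop ℕ∞) (coeffFTilde (2 * k + 3) q f Y) (Ioo ε 1) :=
    (hu.mono hsub).of_le (by exact_mod_cast le_top)
  have hode : ∀ t ∈ Ioo (0 : ℝ) (1 - ε), odeLHS q k (dataH (2 * k + 3) k f Y) t =
      odeRHS q k (coeffFTilde (2 * k + 3) q f Y) t := fun t ht =>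
    odeLHS_kernSeq hu (dataH_eq_kernSeq hf hfc hfB hY) ⟨ht.1, by linarith [ht.2]⟩
  have hr₀ : 1 - ε' ∈ Ioo ε 1 := ⟨hεε', by linarith⟩
  have hinit : ∀ i, iteratedDeriv i (coeffFTilde (2 * k + 3) q f Y) (1 - ε') = 0 := fun i => by
    rw [(coeffFTilde_eventually_zero hfc Y (hsub hr₀) hd).iteratedDeriv_eq i]
    simp
  constructor
  · intro h
    refine eqOn_of_odeRHS_eq hε h.smooth huN (fun t ht => ?_) hr₀ fun i hi => ?_
    · rw [← h.ode t ht, hode t ht]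
    · rw [h.init i hi, hinit i]
  · intro h
    refine ⟨huN.congr h, fun t ht => ?_, fun i _ => ?_⟩
    · rw [hode t ht, odeRHS_congr isOpen_Ioo h ⟨by linarith [ht.2], by linarith [ht.1]⟩]
    · rw [h.iteratedDeriv_of_isOpen isOpen_Ioo i hr₀, hinit i]

end Main

end SphericalMean

end

theorem theorem2p3 (n k : ℕ) (hn : 3 ≤ n) (hodd : Odd n) (hk : k = (n - 3) / 2)
    (ε : ℝ) (hε : 0 < ε)
    (f : SphericalMean.Eucl n → ℂ) (hf : ContDiff ℝ ∞ f) (hfc : HasCompactSupport f)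
    (hfB : tsupport f ⊆ ball (0 : SphericalMean.Eucl n) 1)
    (Y : (q : ℕ) → Fin (SphericalMean.harmonicDim n q) → SphericalMean.USphere n → ℂ)
    (hY : SphericalMean.IsHarmonicBasis n Y) :
    -- all sufficiently small `ε'` are admissible for the initial conditions
    (∃ δ : ℝ, 0 < δ ∧ ∀ ε' : ℝ, 0 < ε' → ε' < δ →
      Disjoint (sphere (0 : SphericalMean.Eucl n) (1 - ε')) (tsupport f)) ∧
    ∀ (q : ℕ) (s : Fin (SphericalMean.harmonicDim n q)),
      -- the functions that are differentiated are smooth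
      ContDiffOn ℝ ∞ (SphericalMean.dataH n k f (Y q s)) (Ioo 0 1) ∧
      ContDiffOn ℝ ∞ (SphericalMean.coeffFTilde n q f (Y q s)) (Ioo 0 1) ∧
      -- the differential equation
      (∀ t ∈ Ioo (0 : ℝ) 1,
        SphericalMean.odeLHS q k (SphericalMean.dataH n k f (Y q s)) t =
          SphericalMean.odeRHS q k (SphericalMean.coeffFTilde n q f (Y q s)) t) ∧
      -- on `(ε, 1)`, its unique solution with zero initial conditions is the wanted coefficient
      (∀ ε' : ℝ, 0 < ε' → ε < 1 - ε' →
        Disjoint (sphere (0 : SphericalMean.Eucl n) (1 - ε')) (tsupport f) →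
        ∀ y : ℝ → ℂ,
          SphericalMean.SolvesIVP q k (SphericalMean.dataH n k f (Y q s)) ε ε' y ↔
            EqOn y (SphericalMean.coeffFTilde n q f (Y q s)) (Ioo ε 1)) := by
  have hn' : n = 2 * k + 3 := by
    obtain ⟨j, rfl⟩ := hodd
    omega
  subst hn'
  refine ⟨SphericalMean.exists_sphere_disjoint_tsupport hfc hfB, fun q s => ?_⟩
  have hYh := hY.harmonic q s
  have hu := SphericalMean.contDiffOn_coeffFTilde (q := q) hf hYh.continuous
  refine ⟨(SphericalMean.contDiff_dataH hf hYh.continuous).contDiffOn,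
    hu.mono fun r hr => hr.1, fun t ht => ?_, fun ε' hε' hεε' hd y => ?_⟩
  · exact SphericalMean.odeLHS_kernSeq hu (SphericalMean.dataH_eq_kernSeq hf hfc hfB hYh) ht
  · exact SphericalMean.solvesIVP_iff hf hfc hfB hYh hε hε' hεε' hd y
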